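/- Let $\mathbf{x}=(x_1,x_2,\dots)$ be commuting indeterminates, let $h_n(\mathbf{x})$ and $s_\lambda(\mathbf{x})$ denote the complete homogeneous symmetric functions and the Schur functions, and let $H(\mathbf{x};z)=\sum_{n\ge 0}h_n(\mathbf{x})z^n$. There are unique families of polynomials $P_\lambda(t), R_\lambda(t)\in\mathbb{R}[t]$, indexed by all integer partitions $\lambda$ (including the empty one), such that $$\frac{(1-t)H(\mathbf{x};z)}{H(\mathbf{x};tz)-tH(\mathbf{x};z)}=\sum_\lambda P_\lambda(t)\,s_\lambda(\mathbf{x})\,z^{|\lambda|},\qquad \frac{1-t}{H(\mathbf{x};tz)-tH(\mathbf{x};z)}=\sum_\lambda R_\lambda(t)\,s_\lambda(\mathbf{x})\,z^{|\lambda|}.$$ For $\lambda\vdash n$ let $\mathrm{SYT}(\lambda)$ be the set of standard Young tableaux of shape $\lambda$ (in English notation); the descent set $\mathrm{Des}(Q)$ of $Q\in\mathrm{SYT}(\lambda)$ is the set of all $i\in\{1,\dots,n-1\}$ such that $i+1$ appears in $Q$ in a lower row than $i$. For integers $a,b$ let $[a,b]=\{i\in\mathbb{Z}:a\le i\le b\}$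 (empty if $a>b$) and $[b]=[1,b]$, and for $\Omega\subseteq\mathbb{Z}$ let $\mathrm{Stab}(\Omega)$ be the set of subsets of $\Omega$ which do not contain two consecutive integers. Then for every $n\ge 1$ and every $\lambda\vdash n$, $$P_\lambda(t)=\sum_{i=0}^{\lfloor (n-1)/2\rfloor}\gamma^\lambda_i\,t^i(1+t)^{n-1-2i},\qquad R_\lambda(t)=\sum_{i=0}^{\lfloor n/2\rfloor}\xi^\lambda_i\,t^i(1+t)^{n-2i},$$ where $\gamma^\lambda_i$ is the number of $Q\in\mathrm{SYT}(\lambda)$ for which $\mathrm{Des}(Q)\in\mathrm{Stab}([n-2])$ and $|\mathrm{Des}(Q)|=i$, and $\xi^\lambda_i$ is the number of $Q\in\mathrm{SYT}(\lambda)$ for which $\mathrm{Des}(Q)\in\mathrm{Stab}([2,n-2])$ and $|\mathrm{Des}(Q)|=i-1$. In particular, for every partition $\lambda$ the polynomials $P_\lambda(t)$ and $R_\lambda(t)$ are $\gamma$-positive, that is, of the form $\sum_{i=0}^{\lfloor m/2\rfloor}\gamma_i\,t^i(1+t)^{m-2i}$ for some $m\in\mathbb{N}$ and some nonnegative reals $\gamma_0,\dots,\gamma_{\lfloor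 m/2\rfloor}$. -/

import Mathlib

open Polynomial

noncomputable section

namespace GammaSchur

/-! Partitions are Young diagrams in English notation: the cell `(i, j)` lies in row `i` and column
`j` (counted from `0`), rows with larger index are lower. A partition of `n` is a Young diagram
with `n` cells. -/

theorem finite_diagrams (n : ℕ) : {μ : YoungDiagram | μ.card = n}.Finite := by
  have h : ((Finset.range n ×ˢ Finset.range n).powerset : Set (Finset (ℕ × ℕ))).Finite :=
    Finset.finite_toSet _
  refine Set.Finite.of_finite_image (f := YoungDiagram.cells) (h.subset ?_) ?_
  · rintro _ ⟨μ, hμ, rfl⟩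
    simp only [Finset.coe_powerset, Set.mem_preimage, Set.mem_powerset_iff]
    rintro ⟨i, j⟩ hc
    have hc' : (i, j) ∈ μ := by simpa using hc
    have hi : (μ.col j).card ≤ μ.card := Finset.card_le_card (Finset.filter_subset _ _)
    have hj : (μ.row i).card ≤ μ.card := Finset.card_le_card (Finset.filter_subset _ _)
    rw [← YoungDiagram.colLen_eq_card] at hi
    rw [← YoungDiagram.rowLen_eq_card] at hj
    have h1 := YoungDiagram.mem_iff_lt_colLen.1 hc'
    have h2 := YoungDiagram.mem_iff_lt_rowLen.1 hc'
    have hn : μ.card = n := hμ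
    simp only [Finset.coe_product, Finset.coe_range, Set.mem_prod, Set.mem_Iio]
    omega
  · intro μ _ ν _ h
    exact YoungDiagram.ext h

/-- The finite set of all partitions of `n`. -/
def partitionsOf (n : ℕ) : Finset YoungDiagram := (finite_diagrams n).toFinset

theorem mem_partitionsOf {n : ℕ} {μ : YoungDiagram} : μ ∈ partitionsOf n ↔ μ.card = n := by
  simp [partitionsOf]

/-! ### Symmetric functions -/

/-- Formal power series in the variables `x₀, x₁, x₂, …` over `ℝ[t]`; the ring in which symmetric
functions with coefficients in `ℝ[t]` live. -/
abbrev SymRing : Type := MvPowerSeries ℕ ℝ[X]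

/-- The complete homogeneous symmetric function `hₙ`: the sum of all monomials of degree `n`. -/
def h (n : ℕ) : SymRing := fun m => if m.degree = n then 1 else 0

/-- The exponent vector of the monomial `x^T` of a semistandard Young tableau `T`. -/
def content {μ : YoungDiagram} (T : SemistandardYoungTableau μ) : ℕ →₀ ℕ :=
  ∑ c ∈ μ.cells, Finsupp.single (T c.1 c.2) 1

/-- The Schur function `s_μ`, the sum of `x^T` over all semistandard Young tableaux `T` of
shape `μ`. -/
def schur (μ : YoungDiagram) : SymRing :=
  fun m => (Nat.card {T : SemistandardYoungTableau μ // content T = m} : ℝ[X])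

/-- Only finitely many tableaux have a given content, so the cardinalities above are genuine. -/
theorem finite_content (μ : YoungDiagram) (m : ℕ →₀ ℕ) :
    Finite {T : SemistandardYoungTableau μ // content T = m} := by
  classical
  have key : ∀ T : {T : SemistandardYoungTableau μ // content T = m}, ∀ c : μ.cells,
      T.1 c.1.1 c.1.2 ∈ m.support := by
    rintro ⟨T, rfl⟩ ⟨c, hc⟩
    simp only [content, Finsupp.mem_support_iff, Finsupp.finsetSum_apply, ne_eq,
      Finset.sum_eq_zero_iff, not_forall]
    exact ⟨c, hc, by simp⟩
  refine Finite.of_injective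
    (fun T => fun c : μ.cells => (⟨T.1 c.1.1 c.1.2, key T c⟩ : m.support)) ?_
  intro T T' hTT
  apply Subtype.ext
  ext i j
  by_cases hij : (i, j) ∈ μ
  · have := congrFun hTT ⟨(i, j), by simpa using hij⟩
    simpa using this
  · rw [T.1.zeros hij, T'.1.zeros hij]

/-- `H(x; z) = ∑ₙ hₙ(x) zⁿ`, as a power series in `z`. -/
def H : PowerSeries SymRing := PowerSeries.mk h

/-- The indeterminate `t`, as an element of the ring of coefficients. -/
def t : SymRing := MvPowerSeries.C (X : ℝ[X])

/-- `H(x; tz)`. -/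
def Ht : PowerSeries SymRing := PowerSeries.rescale t H

/-- The denominator `H(x; tz) - t H(x; z)`. -/
def den : PowerSeries SymRing := Ht - PowerSeries.C t * H

/-- The numerator `(1 - t) H(x; z)` of the generating function of the `P_λ`. -/
def numP : PowerSeries SymRing := PowerSeries.C (1 - t) * H

/-- The numerator `1 - t` of the generating function of the `R_λ`. -/
def numR : PowerSeries SymRing := PowerSeries.C (1 - t)

theorem den_ne_zero : den ≠ 0 := by
  intro h0
  have h1 := congrArg (fun f => MvPowerSeries.coeff 0 (PowerSeries.coeff 0 f)) h0
  have h2 : MvPowerSeries.coeff 0 (h 0) = (1 : ℝ[X]) := by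
    simp [h, MvPowerSeries.coeff_apply]
  simp only [den, Ht, H, t, map_sub, PowerSeries.coeff_rescale, PowerSeries.coeff_C_mul,
    PowerSeries.coeff_mk, pow_zero, one_mul, MvPowerSeries.coeff_C_mul, h2, map_zero] at h1
  have h3 := congrArg (Polynomial.coeff · 1) h1
  simp [Polynomial.coeff_one] at h3

/-- `∑_λ F_λ(t) s_λ(x) z^{|λ|}`, the sum ranging over all partitions (including the empty one). -/
def schurSeries (F : YoungDiagram → ℝ[X]) : PowerSeries SymRing :=
  PowerSeries.mk fun n => ∑ μ ∈ partitionsOf n, MvPowerSeries.C (F μ) * schur μ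

/-- The field of fractions of the integral domain `ℝ[t][[x]][[z]]`. -/
abbrev Frac : Type := FractionRing (PowerSeries SymRing)

/-- `(1 - t) H(x; z) / (H(x; tz) - t H(x; z)) = ∑_λ P_λ(t) s_λ(x) z^{|λ|}`. -/
def IsP (P : YoungDiagram → ℝ[X]) : Prop :=
  algebraMap _ Frac numP / algebraMap _ Frac den = algebraMap _ Frac (schurSeries P)

/-- `(1 - t) / (H(x; tz) - t H(x; z)) = ∑_λ R_λ(t) s_λ(x) z^{|λ|}`. -/
def IsR (R : YoungDiagram → ℝ[X]) : Prop :=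
  algebraMap _ Frac numR / algebraMap _ Frac den = algebraMap _ Frac (schurSeries R)

/-! ### Standard Young tableaux and their descents -/

/-- A standard Young tableau of shape `μ`: the cells are filled bijectively with
`1, …, |μ|`, increasing along rows and down columns; by convention the entry is `0` outside `μ`. -/
@[ext] structure SYT (μ : YoungDiagram) where
  entry : ℕ → ℕ → ℕ
  row_strict : ∀ {i j₁ j₂ : ℕ}, j₁ < j₂ → (i, j₂) ∈ μ → entry i j₁ < entry i j₂
  col_strict : ∀ {i₁ i₂ j : ℕ}, i₁ < i₂ → (i₂, j) ∈ μ → entry i₁ j < entry i₂ j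
  bij : Set.BijOn (fun c : ℕ × ℕ => entry c.1 c.2) μ.cells (Set.Icc 1 μ.card)
  zeros : ∀ {i j : ℕ}, (i, j) ∉ μ → entry i j = 0

instance (μ : YoungDiagram) : Finite (SYT μ) := by
  refine Finite.of_injective
    (fun Q : SYT μ => fun c : μ.cells =>
      (⟨Q.entry c.1.1 c.1.2, Q.bij.mapsTo c.2⟩ : Set.Icc 1 μ.card)) ?_
  intro Q Q' hQ
  ext i j
  by_cases hij : (i, j) ∈ μ
  · have := congrFun hQ ⟨(i, j), by simpa using hij⟩
    simpa using this
  · rw [Q.zeros hij, Q'.zeros hij]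

open Classical in
/-- The descent set of `Q`: all `i ∈ [n - 1]` such that `i + 1` appears in a lower row
than `i`. -/
def Des {μ : YoungDiagram} (Q : SYT μ) : Finset ℕ :=
  {i ∈ Finset.Icc 1 (μ.card - 1) | ∃ c ∈ μ.cells, ∃ d ∈ μ.cells,
    Q.entry c.1 c.2 = i ∧ Q.entry d.1 d.2 = i + 1 ∧ c.1 < d.1}

/-- The stable subsets of `Ω`: those which do not contain two consecutive integers. -/
def Stab (Ω : Finset ℕ) : Set (Finset ℕ) := {S | S ⊆ Ω ∧ ∀ i ∈ S, i + 1 ∉ S}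

/-- `γ^μ_i`: the number of `Q ∈ SYT(μ)`, where `μ ⊢ n`, for which `Des(Q) ∈ Stab([n - 2])`
has `i` elements. -/
def gammaNum (μ : YoungDiagram) (i : ℕ) : ℕ :=
  Nat.card {Q : SYT μ // Des Q ∈ Stab (Finset.Icc 1 (μ.card - 2)) ∧ (Des Q).card = i}

/-- `ξ^μ_i`: the number of `Q ∈ SYT(μ)`, where `μ ⊢ n`, for which `Des(Q) ∈ Stab([2, n - 2])`
has `i - 1` elements (so it is zero for `i = 0`). -/
def xiNum (μ : YoungDiagram) (i : ℕ) : ℕ :=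
  Nat.card {Q : SYT μ // Des Q ∈ Stab (Finset.Icc 2 (μ.card - 2)) ∧ (Des Q).card + 1 = i}

/-- A real polynomial `f` is `γ`-positive if `f = ∑_{i ≤ n/2} γᵢ tⁱ (1 + t)^(n - 2i)` for some
`n ∈ ℕ` and some nonnegative reals `γᵢ`. -/
def GammaPositive (f : ℝ[X]) : Prop :=
  ∃ (n : ℕ) (γ : ℕ → ℝ), (∀ i, 0 ≤ γ i) ∧
    f = ∑ i ∈ Finset.range (n / 2 + 1), C (γ i) * X ^ i * (1 + X) ^ (n - 2 * i)

end GammaSchur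

end

/-!
Write `[k] = 1 + t + ⋯ + t^(k-1)`. Dividing the denominator by `1 - t` gives
`1 - ∑_{n ≥ 2} t [n-1] hₙ zⁿ`. By the Pieri rule (`h_mul_schur`), multiplying a Schur expansion
`∑ F_μ s_μ z^|μ|` by the denominator `∑ (tⁿ - t) hₙ zⁿ` yields the coefficients
`∑_ν (t^|μ/ν| - t) F_ν`, the sum over all `ν` such that `μ / ν` is a horizontal strip
(`coeff_schurSeries_mul_den`). As Schur functions are linearly independent
(`schurSeries_injective`), the families `P` and `R` are characterised by a recursion on shapes.

The recursion is solved by sums `∑_Q w(Des Q)` over standard tableaux. Removing the `a` largest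
entries from a tableau `Q` with no descent among the interior positions of this final segment
gives a tableau on a shape `ν` with `μ / ν` a horizontal strip of size `a`, and this is a bijection
(`SYT.restrictEquiv`), since a horizontal strip has exactly one filling without descents. Thus the
recursion need only be checked for each descent set `D ⊆ {1, …, n-1}`. The set `D` cuts `1, …, n`
into blocks, and the weight is a product over blocks: a block of length `m ≥ 2` contributes
`t (1 + t)^(m-2)`, a block of length `1` contributes `0`, except that for `P` the first block
contributes `(1 + t)^(m-1)`. Only the last block enters the recursion, which becomes a geometric
sum (`conv_blockWeight`, `conv_firstBlockWeight`). For `n ≥ 2` the product vanishes unless `D` is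
stable in `[2, n-2]`, respectively `[n-2]`, and is then `t^(|D|+1) (1 + t)^(n-2|D|-2)`, respectively
`t^|D| (1 + t)^(n-1-2|D|)`; grouping the tableaux by `|Des Q|` gives the two `γ`-expansions.

The Pieri rule is proved in finitely many variables by adding one variable at a time
(`hTrunc_mul_schurTrunc`). The inductive step is the local rule of the
Robinson–Schensted–Knuth correspondence (`card_stripsAbove_inter`), which compares the common upper
and the common lower neighbours of two shapes with respect to horizontal strips.
-/

noncomputable section

namespace GammaSchur

/-! ### Row lengths and horizontal strips -/

theorem fst_lt_card {μ : YoungDiagram} {i j : ℕ} (hc : (i, j) ∈ μ) : i < μ.card := by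
  have h1 := YoungDiagram.mem_iff_lt_colLen.1 hc
  rw [YoungDiagram.colLen_eq_card] at h1
  exact h1.trans_le (Finset.card_le_card (Finset.filter_subset _ _))

theorem rowLen_eq_zero_of_card_le {μ : YoungDiagram} {i : ℕ} (hi : μ.card ≤ i) :
    μ.rowLen i = 0 := by
  by_contra h0
  have : (i, 0) ∈ μ := YoungDiagram.mem_iff_lt_rowLen.2 (Nat.pos_of_ne_zero h0)
  exact absurd (fst_lt_card this) (by omega)

theorem ext_rowLen {μ ν : YoungDiagram} (hr : ∀ i, μ.rowLen i = ν.rowLen i) : μ = ν := by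
  refine YoungDiagram.ext (Finset.ext fun ⟨i, j⟩ => ?_)
  rw [YoungDiagram.mem_cells, YoungDiagram.mem_cells, YoungDiagram.mem_iff_lt_rowLen,
    YoungDiagram.mem_iff_lt_rowLen, hr]

theorem card_filter_fst_lt (μ : YoungDiagram) (N : ℕ) :
    (μ.cells.filter fun c => c.1 < N).card = ∑ i ∈ Finset.range N, μ.rowLen i := by
  rw [Finset.card_eq_sum_card_fiberwise (f := Prod.fst) (t := Finset.range N)]
  · refine Finset.sum_congr rfl fun i hi => ?_
    rw [YoungDiagram.rowLen_eq_card, YoungDiagram.row]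
    congr 1
    ext c
    have := Finset.mem_range.1 hi
    simp only [Finset.mem_filter]
    constructor
    · rintro ⟨⟨h1, h2⟩, h3⟩; exact ⟨h1, h3⟩
    · rintro ⟨h1, h3⟩; exact ⟨⟨h1, by omega⟩, h3⟩
  · intro c hc
    simpa using (Finset.mem_filter.1 hc).2

theorem card_eq_sum_rowLen {μ : YoungDiagram} {N : ℕ} (hN : μ.card ≤ N) :
    μ.card = ∑ i ∈ Finset.range N, μ.rowLen i := by
  rw [← card_filter_fst_lt, Finset.filter_true_of_mem]
  rintro ⟨i, j⟩ hc
  exact (fst_lt_card hc).trans_le hN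

/-- The Young diagram with at most `N` rows whose `i`-th row has length
`min (f 0) … (f i)`; for antitone `f` this is `f i`. -/
def diagramOfRows (f : ℕ → ℕ) (N : ℕ) : YoungDiagram where
  cells := (Finset.range N ×ˢ Finset.range (f 0)).filter fun c => ∀ k ≤ c.1, c.2 < f k
  isLowerSet := by
    rintro ⟨i, j⟩ ⟨i', j'⟩ hle hc
    have h1 : i' ≤ i := hle.1
    have h2 : j' ≤ j := hle.2
    simp only [Finset.coe_filter, Finset.mem_product, Finset.mem_range, Set.mem_ofPred_eq] at hc ⊢
    exact ⟨⟨by omega, by omega⟩, fun k hk => h2.trans_lt (hc.2 k (hk.trans h1))⟩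

theorem rowLen_diagramOfRows {f : ℕ → ℕ} {N : ℕ} (hf : ∀ i, f (i + 1) ≤ f i)
    (hN : ∀ i, N ≤ i → f i = 0) (i : ℕ) : (diagramOfRows f N).rowLen i = f i := by
  have ha : Antitone f := antitone_nat_of_succ_le hf
  refine eq_of_forall_lt_iff fun j => ?_
  rw [← YoungDiagram.mem_iff_lt_rowLen, ← YoungDiagram.mem_cells]
  simp only [diagramOfRows, Finset.mem_filter, Finset.mem_product, Finset.mem_range]
  constructor
  · intro h; exact h.2 i le_rfl
  · intro h
    refine ⟨⟨?_, h.trans_le (ha (Nat.zero_le i))⟩, fun k hk => h.trans_le (ha hk)⟩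
    by_contra hlt
    have := hN i (by omega)
    omega

/-- `λ / ν` is a horizontal strip: `ν ⊆ λ`, and no column contains two cells of `λ / ν`. -/
def IsHorizontalStrip (ν μ : YoungDiagram) : Prop :=
  ν ≤ μ ∧ ∀ i j, (i + 1, j) ∈ μ → (i, j) ∈ ν

/-- A horizontal strip is the same as interlacing of the row lengths. -/
theorem isHorizontalStrip_iff {ν μ : YoungDiagram} :
    IsHorizontalStrip ν μ ↔ ∀ i, μ.rowLen (i + 1) ≤ ν.rowLen i ∧ ν.rowLen i ≤ μ.rowLen i := by
  constructor
  · rintro ⟨h1, h2⟩ i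
    refine ⟨le_of_forall_lt fun j hj => ?_, le_of_forall_lt fun j hj => ?_⟩
    · exact YoungDiagram.mem_iff_lt_rowLen.1 (h2 i j (YoungDiagram.mem_iff_lt_rowLen.2 hj))
    · exact YoungDiagram.mem_iff_lt_rowLen.1 (h1 (YoungDiagram.mem_iff_lt_rowLen.2 hj))
  · intro h
    refine ⟨?_, fun i j hij => ?_⟩
    · rintro ⟨i, j⟩ hij
      have := (YoungDiagram.mem_iff_lt_rowLen (μ := ν)).1 hij
      exact YoungDiagram.mem_iff_lt_rowLen.2 (this.trans_le (h i).2)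
    · have := YoungDiagram.mem_iff_lt_rowLen.1 hij
      exact YoungDiagram.mem_iff_lt_rowLen.2 (this.trans_le (h i).1)

theorem card_le_of_le {ν μ : YoungDiagram} (hle : ν ≤ μ) : ν.card ≤ μ.card :=
  Finset.card_le_card (YoungDiagram.cells_subset_iff.2 hle)

theorem IsHorizontalStrip.card_le {ν μ : YoungDiagram} (hs : IsHorizontalStrip ν μ) :
    ν.card ≤ μ.card := card_le_of_le hs.1

theorem eq_bot_of_card {μ : YoungDiagram} (h0 : μ.card = 0) : μ = ⊥ :=
  YoungDiagram.ext (by rw [Finset.card_eq_zero.1 h0]; rfl)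

theorem card_bot : (⊥ : YoungDiagram).card = 0 := rfl

theorem isHorizontalStrip_bot_right {ν : YoungDiagram} :
    IsHorizontalStrip ν ⊥ ↔ ν = ⊥ := by
  refine ⟨fun hs => le_bot_iff.1 hs.1, ?_⟩
  rintro rfl
  exact ⟨le_rfl, fun i j hij => absurd hij (by simp)⟩

open Classical in
/-- All `ν` such that `μ / ν` is a horizontal strip. -/
def stripsBelow (μ : YoungDiagram) : Finset YoungDiagram :=
  ((Finset.range (μ.card + 1)).biUnion partitionsOf).filter fun ν => IsHorizontalStrip ν μ

theorem mem_stripsBelow {ν μ : YoungDiagram} : ν ∈ stripsBelow μ ↔ IsHorizontalStrip ν μ := by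
  simp only [stripsBelow, Finset.mem_filter, Finset.mem_biUnion, Finset.mem_range,
    mem_partitionsOf, and_iff_right_iff_imp]
  intro hs
  exact ⟨_, Nat.lt_succ_of_le hs.card_le, rfl⟩

open Classical in
/-- All `ξ` of size `n` such that `ξ / μ` is a horizontal strip. -/
def stripsAbove (μ : YoungDiagram) (n : ℕ) : Finset YoungDiagram :=
  (partitionsOf n).filter fun ξ => IsHorizontalStrip μ ξ

theorem mem_stripsAbove {μ ξ : YoungDiagram} {n : ℕ} :
    ξ ∈ stripsAbove μ n ↔ ξ.card = n ∧ IsHorizontalStrip μ ξ := by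
  simp [stripsAbove, mem_partitionsOf]

/-- Sizes under the reflection of row lengths in `card_stripsAbove_inter`. -/
theorem card_add_card_of_toggle {μ ρ ξ ν : YoungDiagram}
    (ht : ∀ i, ξ.rowLen (i + 1) + ν.rowLen i =
      max (μ.rowLen (i + 1)) (ρ.rowLen (i + 1)) + min (μ.rowLen i) (ρ.rowLen i)) :
    ξ.card + ν.card + max (μ.rowLen 0) (ρ.rowLen 0) = ξ.rowLen 0 + μ.card + ρ.card := by
  set N := μ.card + ρ.card + ξ.card + ν.card with hN
  rw [card_eq_sum_rowLen (μ := ξ) (N := N + 1) (by omega),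
    card_eq_sum_rowLen (μ := ν) (N := N) (by omega), Finset.sum_range_succ']
  have h1 : μ.card = ∑ i ∈ Finset.range N, μ.rowLen i := card_eq_sum_rowLen (by omega)
  have h2 : ρ.card = ∑ i ∈ Finset.range N, ρ.rowLen i := card_eq_sum_rowLen (by omega)
  have h3 := Finset.sum_congr (rfl : Finset.range N = _) fun i _ => ht i
  rw [Finset.sum_add_distrib, Finset.sum_add_distrib] at h3
  have h4 : ∑ i ∈ Finset.range N, max (μ.rowLen (i + 1)) (ρ.rowLen (i + 1))
      + max (μ.rowLen 0) (ρ.rowLen 0)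
      = ∑ i ∈ Finset.range N, max (μ.rowLen i) (ρ.rowLen i) := by
    rw [← Finset.sum_range_succ' (fun i => max (μ.rowLen i) (ρ.rowLen i)),
      Finset.sum_range_succ]
    rw [rowLen_eq_zero_of_card_le (μ := μ) (by omega),
      rowLen_eq_zero_of_card_le (μ := ρ) (by omega)]
    simp
  have h5 : ∑ i ∈ Finset.range N, max (μ.rowLen i) (ρ.rowLen i)
      + ∑ i ∈ Finset.range N, min (μ.rowLen i) (ρ.rowLen i)
      = ∑ i ∈ Finset.range N, μ.rowLen i + ∑ i ∈ Finset.range N, ρ.rowLen i := by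
    rw [← Finset.sum_add_distrib, ← Finset.sum_add_distrib]
    exact Finset.sum_congr rfl fun i _ => max_add_min _ _
  omega

open Classical in
/-- The local rule behind the Robinson–Schensted–Knuth correspondence. The row `ξ_{i+1}` of a
common upper neighbour and the row `ν_i` of a common lower neighbour of `μ` and `ρ` range over
the same interval `[max(μ_{i+1}, ρ_{i+1}), min(μ_i, ρ_i)]`; reflecting that interval matches the
two kinds of neighbours, and the first row of `ξ` is then fixed by `|ξ| = n`. -/
theorem card_stripsAbove_inter (μ ρ : YoungDiagram) (n : ℕ) :
    ((stripsAbove μ n) ∩ (stripsAbove ρ n)).card =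
      ((stripsBelow μ ∩ stripsBelow ρ).filter
        fun ν => μ.card + ρ.card ≤ n + ν.card).card := by
  -- The subtractions below do not truncate as long as the strip conditions hold.
  have hrow := fun (μ : YoungDiagram) (i : ℕ) (hi : μ.card ≤ i) =>
    rowLen_eq_zero_of_card_le (μ := μ) hi
  set dn : YoungDiagram → ℕ → ℕ := fun ξ i => max (μ.rowLen (i + 1)) (ρ.rowLen (i + 1)) +
    min (μ.rowLen i) (ρ.rowLen i) - ξ.rowLen (i + 1) with hdn
  set up : YoungDiagram → ℕ → ℕ := fun ν i => match i with
    | 0 => max (μ.rowLen 0) (ρ.rowLen 0) + (n + ν.card - (μ.card + ρ.card))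
    | i + 1 => max (μ.rowLen (i + 1)) (ρ.rowLen (i + 1)) + min (μ.rowLen i) (ρ.rowLen i)
        - ν.rowLen i with hup
  have hdown : ∀ ξ, IsHorizontalStrip μ ξ → IsHorizontalStrip ρ ξ →
      ∀ i, (diagramOfRows (dn ξ) μ.card).rowLen i = dn ξ i := by
    intro ξ h1 h2
    rw [isHorizontalStrip_iff] at h1 h2
    refine rowLen_diagramOfRows (fun i => ?_) (fun i hi => ?_)
    · have a1 := h1 i; have a2 := h2 i; have b1 := h1 (i + 1); have b2 := h2 (i + 1)
      have c1 := h1 (i + 1 + 1); have c2 := h2 (i + 1 + 1)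
      simp only [hdn]; omega
    · have a1 := h1 i; have a2 := h2 i
      have := hrow μ i hi; have := hrow μ (i + 1) (by omega)
      have := h1 (i + 1); have := h2 (i + 1)
      simp only [hdn]; omega
  have hupr : ∀ ν, IsHorizontalStrip ν μ → IsHorizontalStrip ν ρ →
      ∀ i, (diagramOfRows (up ν) (μ.card + ρ.card + 1)).rowLen i = up ν i := by
    intro ν h1 h2
    rw [isHorizontalStrip_iff] at h1 h2
    refine rowLen_diagramOfRows (fun i => ?_) (fun i hi => ?_)
    · have a1 := h1 i; have a2 := h2 i
      have c1 := h1 (i + 1); have c2 := h2 (i + 1)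
      cases i with
      | zero => simp only [hup]; omega
      | succ i =>
        have b1 := h1 i; have b2 := h2 i
        simp only [hup]; omega
    · cases i with
      | zero => omega
      | succ i =>
        have a1 := h1 i; have a2 := h2 i
        have := hrow μ i (by omega); have := hrow μ (i + 1) (by omega)
        have := hrow ρ i (by omega); have := hrow ρ (i + 1) (by omega)
        simp only [hup]; omega
  refine Finset.card_nbij' (fun ξ => diagramOfRows (dn ξ) μ.card)
    (fun ν => diagramOfRows (up ν) (μ.card + ρ.card + 1)) ?_ ?_ ?_ ?_
  · intro ξ hξ
    simp only [Finset.coe_inter, Set.mem_inter_iff, Finset.mem_coe, mem_stripsAbove] at hξ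
    obtain ⟨⟨hc, h1⟩, -, h2⟩ := hξ
    have hd := hdown ξ h1 h2
    rw [isHorizontalStrip_iff] at h1 h2
    have hcard := card_add_card_of_toggle (μ := μ) (ρ := ρ) (ξ := ξ)
      (ν := diagramOfRows (dn ξ) μ.card) (fun i => by
        have a1 := h1 i; have a2 := h2 i; have b1 := h1 (i + 1); have b2 := h2 (i + 1)
        rw [hd]; simp only [hdn]; omega)
    simp only [Finset.coe_filter, Finset.mem_inter, Set.mem_ofPred_eq, mem_stripsBelow,
      isHorizontalStrip_iff, hd]
    refine ⟨⟨fun i => ?_, fun i => ?_⟩, ?_⟩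
    · have a1 := h1 i; have a2 := h2 i; have b1 := h1 (i + 1); have b2 := h2 (i + 1)
      simp only [hdn]; omega
    · have a1 := h1 i; have a2 := h2 i; have b1 := h1 (i + 1); have b2 := h2 (i + 1)
      simp only [hdn]; omega
    · have := h1 0; have := h2 0; omega
  · intro ν hν
    simp only [Finset.coe_filter, Finset.mem_inter, Set.mem_ofPred_eq, mem_stripsBelow] at hν
    obtain ⟨⟨h1, h2⟩, hle⟩ := hν
    have hd := hupr ν h1 h2
    rw [isHorizontalStrip_iff] at h1 h2
    have hcard := card_add_card_of_toggle (μ := μ) (ρ := ρ)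
      (ξ := diagramOfRows (up ν) (μ.card + ρ.card + 1)) (ν := ν) (fun i => by
        have a1 := h1 i; have a2 := h2 i; have b1 := h1 (i + 1); have b2 := h2 (i + 1)
        rw [hd]; simp only [hup]; omega)
    have hc : (diagramOfRows (up ν) (μ.card + ρ.card + 1)).card = n := by
      have hu : up ν 0 = max (μ.rowLen 0) (ρ.rowLen 0) + (n + ν.card - (μ.card + ρ.card)) := rfl
      rw [hd 0, hu] at hcard; omega
    simp only [Finset.coe_inter, Set.mem_inter_iff, Finset.mem_coe, mem_stripsAbove, hc,
      isHorizontalStrip_iff, hd, true_and]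
    refine ⟨fun i => ?_, fun i => ?_⟩
    · have a1 := h1 i; have a2 := h2 i
      cases i with
      | zero => simp only [hup]; omega
      | succ i =>
        have b1 := h1 (i + 1); have b2 := h2 (i + 1); have c1 := h1 i; have c2 := h2 i
        simp only [hup]; omega
    · have a1 := h1 i; have a2 := h2 i
      cases i with
      | zero => simp only [hup]; omega
      | succ i =>
        have b1 := h1 (i + 1); have b2 := h2 (i + 1); have c1 := h1 i; have c2 := h2 i
        simp only [hup]; omega
  · intro ξ hξ
    simp only [Finset.coe_inter, Set.mem_inter_iff, Finset.mem_coe, mem_stripsAbove] at hξ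
    obtain ⟨⟨hc, h1⟩, -, h2⟩ := hξ
    have hd := hdown ξ h1 h2
    have h1' := isHorizontalStrip_iff.1 h1
    have h2' := isHorizontalStrip_iff.1 h2
    have hs1 : IsHorizontalStrip (diagramOfRows (dn ξ) μ.card) μ := by
      rw [isHorizontalStrip_iff]; intro i; rw [hd]
      have a1 := h1' i; have a2 := h2' i; have b1 := h1' (i + 1); have b2 := h2' (i + 1)
      simp only [hdn]; omega
    have hs2 : IsHorizontalStrip (diagramOfRows (dn ξ) μ.card) ρ := by
      rw [isHorizontalStrip_iff]; intro i; rw [hd]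
      have a1 := h1' i; have a2 := h2' i; have b1 := h1' (i + 1); have b2 := h2' (i + 1)
      simp only [hdn]; omega
    have hcard := card_add_card_of_toggle (μ := μ) (ρ := ρ) (ξ := ξ)
      (ν := diagramOfRows (dn ξ) μ.card) (fun i => by
        have a1 := h1' i; have a2 := h2' i; have b1 := h1' (i + 1); have b2 := h2' (i + 1)
        rw [hd]; simp only [hdn]; omega)
    refine ext_rowLen fun i => ?_
    rw [hupr _ hs1 hs2]
    cases i with
    | zero => have := h1' 0; have := h2' 0; simp only [hup]; omega
    | succ i =>
      have a1 := h1' i; have a2 := h2' i; have b1 := h1' (i + 1); have b2 := h2' (i + 1)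
      simp only [hup, hd]; simp only [hdn]; omega
  · intro ν hν
    simp only [Finset.coe_filter, Finset.mem_inter, Set.mem_ofPred_eq, mem_stripsBelow] at hν
    obtain ⟨⟨h1, h2⟩, hle⟩ := hν
    have hd := hupr ν h1 h2
    have h1' := isHorizontalStrip_iff.1 h1
    have h2' := isHorizontalStrip_iff.1 h2
    have hs : ∀ κ, (κ = μ ∨ κ = ρ) →
        IsHorizontalStrip κ (diagramOfRows (up ν) (μ.card + ρ.card + 1)) := by
      intro κ hκ
      rw [isHorizontalStrip_iff]; intro i; rw [hd, hd]
      have a1 := h1' i; have a2 := h2' i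
      cases i with
      | zero => rcases hκ with rfl | rfl <;> simp only [hup] <;> omega
      | succ i =>
        have b1 := h1' (i + 1); have b2 := h2' (i + 1); have c1 := h1' i; have c2 := h2' i
        rcases hκ with rfl | rfl <;> simp only [hup] <;> omega
    refine ext_rowLen fun i => ?_
    rw [hdown _ (hs μ (Or.inl rfl)) (hs ρ (Or.inr rfl))]
    have a1 := h1' i; have a2 := h2' i; have b1 := h1' (i + 1); have b2 := h2' (i + 1)
    simp only [hdn, hd]; simp only [hup]; omega

/-! ### The Pieri rule in finitely many variables -/

open Classical in
/-- The Schur polynomial `s_μ(x₀, …, x_{N-1})`, built by branching: the cells holding the largest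
entry form a horizontal strip. -/
def schurTrunc : ℕ → YoungDiagram → SymRing
  | 0, μ => if μ = ⊥ then 1 else 0
  | N + 1, μ => ∑ ν ∈ stripsBelow μ, MvPowerSeries.X N ^ (μ.card - ν.card) * schurTrunc N ν

/-- The complete homogeneous polynomial `hₙ(x₀, …, x_{N-1})`. -/
def hTrunc : ℕ → ℕ → SymRing
  | 0, n => if n = 0 then 1 else 0
  | N + 1, n => ∑ k ∈ Finset.range (n + 1), MvPowerSeries.X N ^ k * hTrunc N (n - k)

open Classical in
theorem sum_stripsAbove_range (ν : YoungDiagram) (n : ℕ) (g : YoungDiagram → SymRing) :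
    ∑ k ∈ Finset.range (n + 1), ∑ ρ ∈ stripsAbove ν (ν.card + (n - k)), g ρ =
      ∑ ρ ∈ (Finset.range (ν.card + n + 1)).biUnion (stripsAbove ν), g ρ := by
  rw [← Finset.sum_fiberwise_of_maps_to (s := (Finset.range (ν.card + n + 1)).biUnion
    (stripsAbove ν)) (t := Finset.range (n + 1)) (g := fun ρ => ν.card + n - ρ.card)]
  · refine Finset.sum_congr rfl fun k hk => Finset.sum_congr ?_ fun _ _ => rfl
    ext ρ
    have := Finset.mem_range.1 hk
    simp only [Finset.mem_filter, Finset.mem_biUnion, Finset.mem_range, mem_stripsAbove]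
    constructor
    · rintro ⟨h1, h2⟩
      exact ⟨⟨ρ.card, by omega, rfl, h2⟩, by omega⟩
    · rintro ⟨⟨a, h1, h2, h3⟩, h4⟩
      have := h3.card_le
      exact ⟨by omega, h3⟩
  · intro ρ hρ
    simp only [Finset.mem_biUnion, Finset.mem_range, mem_stripsAbove] at hρ ⊢
    obtain ⟨a, h1, h2, h3⟩ := hρ
    have := h3.card_le
    omega

/-- The Pieri rule in `N` variables. In the inductive step the two sides count, for each `ρ`, the
common upper and the common lower neighbours of `μ` and `ρ`, so that they agree by
`card_stripsAbove_inter`. -/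
theorem hTrunc_mul_schurTrunc (N n : ℕ) (μ : YoungDiagram) :
    hTrunc N n * schurTrunc N μ = ∑ ξ ∈ stripsAbove μ (μ.card + n), schurTrunc N ξ := by
  classical
  induction N generalizing n μ with
  | zero =>
    simp only [hTrunc, schurTrunc, Finset.sum_ite_eq', mem_stripsAbove,
      isHorizontalStrip_bot_right, card_bot]
    by_cases h1 : μ = ⊥
    · subst h1
      by_cases h2 : n = 0
      · simp [h2, card_bot]
      · simp [h2, card_bot, Ne.symm h2]
    · simp [h1]
  | succ N ih =>
    set L := μ.card + n with hL
    set g : YoungDiagram → SymRing := fun ρ =>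
      MvPowerSeries.X N ^ (L - ρ.card) * schurTrunc N ρ with hg
    set U : Finset YoungDiagram := (Finset.range (L + 1)).biUnion partitionsOf with hU
    have memU : ∀ ρ, ρ ∈ U ↔ ρ.card ≤ L := by
      intro ρ
      simp [hU, mem_partitionsOf]
    have rhs : ∑ ξ ∈ stripsAbove μ L, schurTrunc (N + 1) ξ =
        ∑ ρ ∈ U, ((stripsAbove μ L ∩ stripsAbove ρ L).card : SymRing) * g ρ := by
      have h1 : ∑ ξ ∈ stripsAbove μ L, schurTrunc (N + 1) ξ =
          ∑ ξ ∈ stripsAbove μ L, ∑ ρ ∈ stripsBelow ξ, g ρ := by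
        refine Finset.sum_congr rfl fun ξ hξ => Finset.sum_congr rfl fun ρ _ => ?_
        rw [(mem_stripsAbove.1 hξ).1]
      rw [h1, Finset.sum_comm' (t' := U) (s' := fun ρ => stripsAbove μ L ∩ stripsAbove ρ L)]
      · simp [nsmul_eq_mul]
      · intro ξ ρ
        simp only [mem_stripsAbove, mem_stripsBelow, Finset.mem_inter, memU]
        constructor
        · rintro ⟨⟨h1, h2⟩, h3⟩
          exact ⟨⟨⟨h1, h2⟩, h1, h3⟩, h1 ▸ h3.card_le⟩
        · rintro ⟨⟨⟨h1, h2⟩, -, h3⟩, -⟩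
          exact ⟨⟨h1, h2⟩, h3⟩
    have lhs : hTrunc (N + 1) n * schurTrunc (N + 1) μ =
        ∑ ρ ∈ U, (((stripsBelow μ ∩ stripsBelow ρ).filter
          fun ν => μ.card + ρ.card ≤ L + ν.card).card : SymRing) * g ρ := by
      have h1 : hTrunc (N + 1) n * schurTrunc (N + 1) μ =
          ∑ ν ∈ stripsBelow μ, ∑ k ∈ Finset.range (n + 1),
            ∑ ρ ∈ stripsAbove ν (ν.card + (n - k)), g ρ := by
        rw [hTrunc, schurTrunc, Finset.sum_mul_sum, Finset.sum_comm]
        refine Finset.sum_congr rfl fun ν hν => Finset.sum_congr rfl fun k hk => ?_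
        have h2 := (mem_stripsBelow.1 hν).card_le
        have h3 := Finset.mem_range.1 hk
        rw [mul_mul_mul_comm, ih, ← pow_add, Finset.mul_sum]
        refine Finset.sum_congr rfl fun ρ hρ => ?_
        have h4 := (mem_stripsAbove.1 hρ).1
        rw [hg]
        simp only
        congr 2
        omega
      simp_rw [h1, sum_stripsAbove_range]
      rw [Finset.sum_comm' (t' := U) (s' := fun ρ => (stripsBelow μ ∩ stripsBelow ρ).filter
          fun ν => μ.card + ρ.card ≤ L + ν.card)]
      · simp [nsmul_eq_mul]
      · intro ν ρ
        simp only [mem_stripsAbove, mem_stripsBelow, Finset.mem_inter, memU, Finset.mem_filter,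
          Finset.mem_biUnion, Finset.mem_range]
        constructor
        · rintro ⟨h1, a, h2, h3, h4⟩
          have := h1.card_le
          exact ⟨⟨⟨h1, h4⟩, by omega⟩, by omega⟩
        · rintro ⟨⟨⟨h1, h4⟩, h2⟩, h3⟩
          exact ⟨h1, ρ.card, by omega, rfl, h4⟩
    rw [lhs, rhs]
    refine Finset.sum_congr rfl fun ρ _ => ?_
    rw [card_stripsAbove_inter]

/-! ### Coefficients of Schur functions -/

theorem content_apply {μ : YoungDiagram} (T : SemistandardYoungTableau μ) (k : ℕ) :
    content T k = (μ.cells.filter fun c => T c.1 c.2 = k).card := by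
  classical
  rw [content, Finsupp.finsetSum_apply, Finset.card_filter]
  exact Finset.sum_congr rfl fun c _ => by rw [Finsupp.single_apply]

theorem entry_mem_support_content {μ : YoungDiagram} (T : SemistandardYoungTableau μ)
    {c : ℕ × ℕ} (hc : c ∈ μ) : T c.1 c.2 ∈ (content T).support := by
  rw [Finsupp.mem_support_iff, content_apply]
  exact Finset.card_ne_zero.2 ⟨c, by simpa using hc⟩

/-- The shape formed by the cells of `T` with entry less than `N`. -/
def shapeBelow {μ : YoungDiagram} (T : SemistandardYoungTableau μ) (N : ℕ) : YoungDiagram where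
  cells := μ.cells.filter fun c => T c.1 c.2 < N
  isLowerSet := by
    rintro ⟨i, j⟩ ⟨i', j'⟩ hle hc
    have h1 : i' ≤ i := hle.1
    have h2 : j' ≤ j := hle.2
    simp only [Finset.coe_filter, YoungDiagram.mem_cells, Set.mem_ofPred_eq] at hc ⊢
    refine ⟨μ.up_left_mem h1 h2 hc.1, ?_⟩
    have h3 := T.row_weak_of_le h2 (μ.up_left_mem h1 le_rfl hc.1)
    have h4 := T.col_weak h1 hc.1
    omega

theorem mem_shapeBelow {μ : YoungDiagram} {T : SemistandardYoungTableau μ} {N : ℕ} {c : ℕ × ℕ} :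
    c ∈ shapeBelow T N ↔ c ∈ μ ∧ T c.1 c.2 < N := by
  rw [← YoungDiagram.mem_cells]
  simp [shapeBelow]

/-- The restriction of a semistandard tableau to a smaller shape. -/
def restrictSSYT {ν μ : YoungDiagram} (hle : ν ≤ μ) (T : SemistandardYoungTableau μ) :
    SemistandardYoungTableau ν where
  entry i j := if (i, j) ∈ ν then T i j else 0
  row_weak' := by
    intro i j1 j2 hj hc
    rw [if_pos hc, if_pos (ν.up_left_mem le_rfl hj.le hc)]
    exact T.row_weak hj (hle hc)
  col_strict' := by
    intro i1 i2 j hi hc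
    rw [if_pos hc, if_pos (ν.up_left_mem hi.le le_rfl hc)]
    exact T.col_strict hi (hle hc)
  zeros' := fun hc => if_neg hc

theorem restrictSSYT_apply {ν μ : YoungDiagram} (hle : ν ≤ μ) (T : SemistandardYoungTableau μ)
    (i j : ℕ) : restrictSSYT hle T i j = if (i, j) ∈ ν then T i j else 0 := rfl

/-- The extension of a semistandard tableau with entries less than `N` by a horizontal strip
filled with `N`. -/
def extendSSYT {ν μ : YoungDiagram} (hs : IsHorizontalStrip ν μ) (T : SemistandardYoungTableau ν)
    (N : ℕ) (hT : ∀ i j, (i, j) ∈ ν → T i j < N) : SemistandardYoungTableau μ where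
  entry i j := if (i, j) ∈ ν then T i j else if (i, j) ∈ μ then N else 0
  row_weak' := by
    intro i j1 j2 hj hc
    have hc1 := μ.up_left_mem (le_refl i) hj.le hc
    by_cases h2 : (i, j2) ∈ ν
    · rw [if_pos h2, if_pos (ν.up_left_mem le_rfl hj.le h2)]
      exact T.row_weak hj h2
    · rw [if_neg h2, if_pos hc, if_pos hc1]
      split_ifs with h1
      · exact (hT _ _ h1).le
      · exact le_rfl
  col_strict' := by
    intro i1 i2 j hi hc
    by_cases h2 : (i2, j) ∈ ν
    · rw [if_pos h2, if_pos (ν.up_left_mem hi.le le_rfl h2)]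
      exact T.col_strict hi h2
    · obtain ⟨i, rfl⟩ := Nat.exists_eq_add_of_lt hi
      have h1 : (i1, j) ∈ ν := ν.up_left_mem (Nat.le_add_right _ _) le_rfl (hs.2 _ _ hc)
      rw [if_pos h1, if_neg h2, if_pos hc]
      exact hT _ _ h1
  zeros' := by
    intro i j hc
    rw [if_neg fun h => hc (hs.1 h), if_neg hc]

theorem extendSSYT_apply {ν μ : YoungDiagram} (hs : IsHorizontalStrip ν μ)
    (T : SemistandardYoungTableau ν) (N : ℕ) (hT : ∀ i j, (i, j) ∈ ν → T i j < N) (i j : ℕ) :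
    extendSSYT hs T N hT i j = if (i, j) ∈ ν then T i j else if (i, j) ∈ μ then N else 0 := rfl

theorem card_cells_sdiff {ν μ : YoungDiagram} (hle : ν ≤ μ) :
    (μ.cells.filter fun c => c ∉ ν).card = μ.card - ν.card := by
  have h1 := Finset.card_filter_add_card_filter_not (s := μ.cells) fun c => c ∈ ν
  have h2 : (μ.cells.filter fun c => c ∈ ν) = ν.cells := by
    ext c
    simp only [Finset.mem_filter, YoungDiagram.mem_cells]
    exact ⟨fun h => h.2, fun h => ⟨hle h, h⟩⟩
  rw [h2] at h1
  change ν.card + _ = μ.card at h1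
  omega

/-- Deleting the entries `N` from the tableaux with a prescribed shape `ν` of smaller entries. -/
theorem card_ssyt_fiber {ν μ : YoungDiagram} (hs : IsHorizontalStrip ν μ) (m : ℕ →₀ ℕ) (N : ℕ)
    (hm : ∀ i ∈ m.support, i < N + 1) (hc : μ.card - ν.card = m N) :
    Nat.card {T : SemistandardYoungTableau μ //
        content T = m ∧ ∀ c ∈ μ, (T c.1 c.2 < N ↔ c ∈ ν)} =
      Nat.card {T : SemistandardYoungTableau ν // content T = m.erase N} := by
  have hlt : ∀ T : SemistandardYoungTableau ν, content T = m.erase N →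
      ∀ i j, (i, j) ∈ ν → T i j < N := by
    intro T hT i j hij
    have h1 := entry_mem_support_content T hij
    rw [hT, Finsupp.support_erase, Finset.mem_erase] at h1
    have := hm _ h1.2
    have := h1.1
    simp only at *
    omega
  refine Nat.card_congr ⟨fun T => ⟨restrictSSYT hs.1 T.1, ?_⟩,
    fun T => ⟨extendSSYT hs T.1 N (hlt T.1 T.2), ?_, ?_⟩, ?_, ?_⟩
  · obtain ⟨T, rfl, hT⟩ := T
    ext k
    by_cases hk : k = N
    · subst hk
      rw [Finsupp.erase_same, content_apply, Finset.card_eq_zero, Finset.filter_eq_empty_iff]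
      rintro ⟨i, j⟩ hij
      rw [YoungDiagram.mem_cells] at hij
      have := (hT _ (hs.1 hij)).2 hij
      simp only [restrictSSYT_apply, if_pos hij] at this ⊢
      omega
    · rw [Finsupp.erase_ne hk, content_apply, content_apply]
      congr 1
      ext ⟨i, j⟩
      rw [Finset.mem_filter, Finset.mem_filter]
      simp only [YoungDiagram.mem_cells, restrictSSYT_apply]
      constructor
      · rintro ⟨h1, h2⟩
        rw [if_pos h1] at h2
        exact ⟨hs.1 h1, h2⟩
      · rintro ⟨h1, h2⟩
        have h3 := hm _ (entry_mem_support_content T h1)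
        have h4 : (i, j) ∈ ν := (hT _ h1).1 (by simp only at h3 ⊢; omega)
        exact ⟨h4, by rw [if_pos h4, h2]⟩
  · obtain ⟨T, hT⟩ := T
    have hlT := hlt T hT
    ext k
    rw [content_apply]
    by_cases hk : k = N
    · subst hk
      rw [← hc, ← card_cells_sdiff hs.1]
      congr 1
      refine Finset.filter_congr ?_
      rintro ⟨i, j⟩ hij
      rw [YoungDiagram.mem_cells] at hij
      rw [extendSSYT_apply]
      by_cases h1 : (i, j) ∈ ν
      · have := hlT i j h1
        simp only [h1, if_true, not_true, iff_false]; omega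
      · simp [h1, hij]
    · have h0 : content T k = m k := by rw [hT, Finsupp.erase_ne hk]
      rw [← h0, content_apply]
      congr 1
      ext ⟨i, j⟩
      rw [Finset.mem_filter, Finset.mem_filter]
      simp only [YoungDiagram.mem_cells, extendSSYT_apply]
      by_cases h1 : (i, j) ∈ ν
      · simp [h1, hs.1 h1]
      · by_cases h2 : (i, j) ∈ μ
        · simp only [h1, h2, if_true, if_false, true_and, false_and, iff_false]
          exact Ne.symm hk
        · simp [h1, h2]
  · rintro ⟨i, j⟩ hij
    simp only [extendSSYT_apply]
    by_cases h1 : (i, j) ∈ ν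
    · simp [h1, hlt T.1 T.2 i j h1]
    · simp [h1, hij]
  · rintro ⟨T, hT0, hT⟩
    apply Subtype.ext
    ext i j
    simp only [extendSSYT_apply, restrictSSYT_apply]
    by_cases h1 : (i, j) ∈ ν
    · simp [h1]
    · by_cases h2 : (i, j) ∈ μ
      · rw [if_neg h1, if_pos h2]
        have h3 := (hT _ h2).not.2 h1
        have h4 := hm _ (hT0 ▸ entry_mem_support_content T h2)
        simp only at h3 h4
        omega
      · rw [if_neg h1, if_neg h2, T.zeros h2]
  · rintro ⟨T, hT⟩
    apply Subtype.ext
    ext i j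
    simp only [extendSSYT_apply, restrictSSYT_apply]
    by_cases h1 : (i, j) ∈ ν
    · simp [h1]
    · simp [h1, T.zeros h1]

theorem isHorizontalStrip_shapeBelow {μ : YoungDiagram} (T : SemistandardYoungTableau μ) {N : ℕ}
    (hT : ∀ i ∈ (content T).support, i < N + 1) : IsHorizontalStrip (shapeBelow T N) μ := by
  refine ⟨fun c hc => (mem_shapeBelow.1 hc).1, fun i j hij => ?_⟩
  refine mem_shapeBelow.2 ⟨μ.up_left_mem (Nat.le_succ i) le_rfl hij, ?_⟩
  have h1 := T.col_strict (Nat.lt_succ_self i) hij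
  have h2 : T (i + 1) j < N + 1 := hT _ (entry_mem_support_content T hij)
  exact h1.trans_le (Nat.le_of_lt_succ h2)

theorem card_sub_card_shapeBelow {μ : YoungDiagram} (T : SemistandardYoungTableau μ) {N : ℕ}
    (hT : ∀ i ∈ (content T).support, i < N + 1) :
    μ.card - (shapeBelow T N).card = content T N := by
  rw [← card_cells_sdiff (isHorizontalStrip_shapeBelow T hT).1, content_apply]
  congr 1
  refine Finset.filter_congr fun c hc => ?_
  rw [YoungDiagram.mem_cells] at hc
  have := hT _ (entry_mem_support_content T hc)
  rw [mem_shapeBelow]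
  simp only [hc, true_and]
  omega

/-- The branching rule for semistandard tableaux, on the level of their numbers. -/
theorem card_ssyt_succ (μ : YoungDiagram) (m : ℕ →₀ ℕ) (N : ℕ)
    (hm : ∀ i ∈ m.support, i < N + 1) :
    Nat.card {T : SemistandardYoungTableau μ // content T = m} =
      ∑ ν ∈ stripsBelow μ, if m N = μ.card - ν.card then
        Nat.card {T : SemistandardYoungTableau ν // content T = m.erase N} else 0 := by
  classical
  have := finite_content μ m
  have := Fintype.ofFinite {T : SemistandardYoungTableau μ // content T = m}
  rw [Nat.card_eq_fintype_card, ← Finset.card_univ, ← Finset.sum_filter,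
    Finset.card_eq_sum_card_fiberwise (f := fun T => shapeBelow T.1 N)
      (t := (stripsBelow μ).filter fun ν => m N = μ.card - ν.card)]
  · refine Finset.sum_congr rfl fun ν hν => ?_
    obtain ⟨h1, h2⟩ := Finset.mem_filter.1 hν
    rw [← card_ssyt_fiber (mem_stripsBelow.1 h1) m N hm h2.symm, ← Fintype.card_subtype,
      ← Nat.card_eq_fintype_card]
    refine Nat.card_congr ((Equiv.subtypeEquivRight ?_).trans
      (Equiv.subtypeSubtypeEquivSubtypeInter _
        (fun T : SemistandardYoungTableau μ => ∀ c ∈ μ, (T c.1 c.2 < N ↔ c ∈ ν))))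
    rintro ⟨T, hT⟩
    constructor
    · rintro rfl c hc
      rw [mem_shapeBelow]
      simp [hc]
    · intro h3
      refine YoungDiagram.ext (Finset.ext fun c => ?_)
      rw [YoungDiagram.mem_cells, YoungDiagram.mem_cells, mem_shapeBelow]
      constructor
      · rintro ⟨h4, h5⟩; exact (h3 c h4).1 h5
      · intro h4
        have h5 := (mem_stripsBelow.1 h1).1 h4
        exact ⟨h5, (h3 c h5).2 h4⟩
  · rintro ⟨T, rfl⟩ -
    simp only [Finset.coe_filter, Set.mem_ofPred_eq, mem_stripsBelow]
    exact ⟨isHorizontalStrip_shapeBelow T hm, (card_sub_card_shapeBelow T hm).symm⟩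

theorem coeff_schur (μ : YoungDiagram) (m : ℕ →₀ ℕ) :
    MvPowerSeries.coeff m (schur μ) =
      (Nat.card {T : SemistandardYoungTableau μ // content T = m} : ℝ[X]) := rfl

theorem coeff_h (n : ℕ) (m : ℕ →₀ ℕ) :
    MvPowerSeries.coeff m (h n) = if m.degree = n then 1 else 0 := rfl

/-- For a series in `x₀, …, x_{N-1}` the exponent of `x_N` in `x_N^k f` is `k`. -/
theorem coeff_X_pow_mul_trunc {f : SymRing} {N : ℕ}
    (hf : ∀ m : ℕ →₀ ℕ, ¬ (∀ i ∈ m.support, i < N) → MvPowerSeries.coeff m f = 0)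
    (k : ℕ) (m : ℕ →₀ ℕ) :
    MvPowerSeries.coeff m (MvPowerSeries.X N ^ k * f) =
      if m N = k then MvPowerSeries.coeff (m.erase N) f else 0 := by
  classical
  rw [MvPowerSeries.X_pow_eq, MvPowerSeries.coeff_monomial_mul, one_mul]
  by_cases h1 : m N = k
  · subst h1
    rw [if_pos (by simp), if_pos rfl]
    suffices he : m - Finsupp.single N (m N) = m.erase N by rw [he]
    ext i
    rw [Finsupp.tsub_apply, Finsupp.single_apply, Finsupp.erase_apply]
    by_cases hi : N = i
    · simp [hi]
    · simp [hi, Ne.symm hi]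
  · rw [if_neg h1]
    split_ifs with h2
    · refine hf _ fun h3 => ?_
      have h4 : k ≤ m N := by simpa using h2
      have := h3 N (by simp; omega)
      omega
    · rfl

theorem support_erase_lt {m : ℕ →₀ ℕ} {N : ℕ} :
    (∀ i ∈ (m.erase N).support, i < N) ↔ ∀ i ∈ m.support, i < N + 1 := by
  simp only [Finsupp.support_erase, Finset.mem_erase]
  constructor
  · intro h1 i hi
    by_cases h2 : i = N
    · omega
    · have := h1 i ⟨h2, hi⟩; omega
  · rintro h1 i ⟨h2, hi⟩
    have := h1 i hi; omega

theorem content_degree {μ : YoungDiagram} (T : SemistandardYoungTableau μ) :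
    (content T).degree = μ.card := by
  simp [content, map_sum, YoungDiagram.card]

theorem coeff_schurTrunc (N : ℕ) (μ : YoungDiagram) (m : ℕ →₀ ℕ) :
    MvPowerSeries.coeff m (schurTrunc N μ) =
      if ∀ i ∈ m.support, i < N then MvPowerSeries.coeff m (schur μ) else 0 := by
  classical
  induction N generalizing μ m with
  | zero =>
    have h0 : (∀ i ∈ m.support, i < 0) ↔ m = 0 := by
      rw [← Finsupp.support_eq_empty, Finset.eq_empty_iff_forall_notMem]
      simp
    simp only [h0, schurTrunc]
    by_cases hm : m = 0
    · subst hm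
      rw [if_pos rfl, coeff_schur]
      by_cases hμ : μ = ⊥
      · subst hμ
        have h1 : Nat.card {T : SemistandardYoungTableau ⊥ // content T = 0} = 1 := by
          rw [Nat.card_eq_one_iff_unique]
          refine ⟨⟨?_⟩, ⟨⟨default, ?_⟩⟩⟩
          · rintro ⟨T, -⟩ ⟨T', -⟩
            apply Subtype.ext
            ext i j
            rw [T.zeros (by simp), T'.zeros (by simp)]
          · simp [content]
        rw [h1]; simp
      · have h1 : IsEmpty {T : SemistandardYoungTableau μ // content T = 0} := by
          refine ⟨fun ⟨T, hT⟩ => hμ (eq_bot_of_card ?_)⟩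
          rw [← content_degree T, hT]; simp
        simp [hμ]
    · rw [if_neg hm]
      split_ifs
      · rw [MvPowerSeries.coeff_one, if_neg hm]
      · simp
  | succ N ih =>
    have hz : ∀ ν, ∀ m : ℕ →₀ ℕ, ¬ (∀ i ∈ m.support, i < N) →
        MvPowerSeries.coeff m (schurTrunc N ν) = 0 := by
      intro ν m hm
      rw [ih, if_neg hm]
    rw [schurTrunc, map_sum]
    simp_rw [fun ν => coeff_X_pow_mul_trunc (hz ν), ih, support_erase_lt]
    split_ifs with hm
    · rw [coeff_schur, card_ssyt_succ μ m N hm]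
      simp only [coeff_schur]
      push_cast
      rfl
    · simp

theorem coeff_hTrunc (N : ℕ) (n : ℕ) (m : ℕ →₀ ℕ) :
    MvPowerSeries.coeff m (hTrunc N n) =
      if ∀ i ∈ m.support, i < N then MvPowerSeries.coeff m (h n) else 0 := by
  classical
  induction N generalizing n m with
  | zero =>
    have h0 : (∀ i ∈ m.support, i < 0) ↔ m = 0 := by
      rw [← Finsupp.support_eq_empty, Finset.eq_empty_iff_forall_notMem]
      simp
    simp only [h0, hTrunc, coeff_h]
    by_cases hm : m = 0
    · subst hm
      by_cases hn : n = 0 <;> simp [hn, eq_comm]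
    · rw [if_neg hm]
      split_ifs
      · rw [MvPowerSeries.coeff_one, if_neg hm]
      · simp
  | succ N ih =>
    have hz : ∀ n, ∀ m : ℕ →₀ ℕ, ¬ (∀ i ∈ m.support, i < N) →
        MvPowerSeries.coeff m (hTrunc N n) = 0 := by
      intro ν m hm
      rw [ih, if_neg hm]
    rw [hTrunc, map_sum]
    simp_rw [fun ν => coeff_X_pow_mul_trunc (hz ν), ih, support_erase_lt]
    split_ifs with hm
    · have hd : m.degree = m N + (m.erase N).degree := by
        conv_lhs => rw [← Finsupp.single_add_erase N m]
        simp
      rw [Finset.sum_ite_eq]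
      simp only [coeff_h, Finset.mem_range]
      by_cases h1 : m.degree = n
      · rw [if_pos h1, if_pos (by omega), if_pos (by omega)]
      · rw [if_neg h1]
        split_ifs <;> first | omega | rfl
    · simp

/-- The Pieri rule `hₙ s_μ = ∑ s_ξ`, over all `ξ` such that `ξ / μ` is a horizontal strip of
size `n`. -/
theorem h_mul_schur (n : ℕ) (μ : YoungDiagram) :
    h n * schur μ = ∑ ξ ∈ stripsAbove μ (μ.card + n), schur ξ := by
  classical
  ext1 m
  -- Only the variables occurring in the monomial `m` matter for its coefficient.
  obtain ⟨N, hN⟩ : ∃ N, ∀ i ∈ m.support, i < N :=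
    ⟨m.support.sup id + 1, fun i hi => Nat.lt_succ_of_le (Finset.le_sup (f := id) hi)⟩
  have key := congrArg (MvPowerSeries.coeff m) (hTrunc_mul_schurTrunc N n μ)
  rw [MvPowerSeries.coeff_mul, map_sum] at key ⊢
  simp_rw [coeff_schurTrunc, if_pos hN] at key
  rw [← key]
  refine Finset.sum_congr rfl fun p hp => ?_
  have hp' := Finset.HasAntidiagonal.mem_antidiagonal.1 hp
  rw [coeff_hTrunc, if_pos, if_pos]
  · intro i hi
    refine hN i ?_
    rw [← hp', Finsupp.mem_support_iff, Finsupp.add_apply]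
    have := Finsupp.mem_support_iff.1 hi
    omega
  · intro i hi
    refine hN i ?_
    rw [← hp', Finsupp.mem_support_iff, Finsupp.add_apply]
    have := Finsupp.mem_support_iff.1 hi
    omega

theorem schur_bot : schur ⊥ = 1 := by
  ext1 m
  by_cases hm : m = 0
  · subst hm
    have := coeff_schurTrunc 0 ⊥ 0
    simpa [schurTrunc] using this.symm
  · rw [MvPowerSeries.coeff_one, if_neg hm, coeff_schur]
    have h1 : IsEmpty {T : SemistandardYoungTableau ⊥ // content T = m} := by
      refine ⟨fun ⟨T, hT⟩ => hm ?_⟩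
      rw [← hT]; simp [content]
    simp

theorem h_eq_sum_schur (n : ℕ) : h n = ∑ ξ ∈ stripsAbove ⊥ n, schur ξ := by
  have := h_mul_schur n ⊥
  rwa [schur_bot, mul_one, card_bot, zero_add] at this

/-! ### Linear independence of the Schur functions -/

theorem fst_le_entry {μ : YoungDiagram} (T : SemistandardYoungTableau μ) (i j : ℕ)
    (hc : (i, j) ∈ μ) : i ≤ T i j := by
  induction i with
  | zero => exact Nat.zero_le _
  | succ i ih =>
    have h1 := ih (μ.up_left_mem (Nat.le_succ i) le_rfl hc)
    have h2 := T.col_strict (Nat.lt_succ_self i) hc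
    exact h1.trans_lt h2

theorem content_highestWeight (μ : YoungDiagram) (k : ℕ) :
    content (SemistandardYoungTableau.highestWeight μ) k = μ.rowLen k := by
  rw [content_apply, YoungDiagram.rowLen_eq_card, YoungDiagram.row]
  congr 1
  refine Finset.filter_congr ?_
  rintro ⟨i, j⟩ hc
  rw [YoungDiagram.mem_cells] at hc
  simp [hc]

/-- The content of a semistandard tableau is dominated by its shape. -/
theorem sum_content_le {μ : YoungDiagram} (T : SemistandardYoungTableau μ) (i : ℕ) :
    ∑ k ∈ Finset.range i, content T k ≤ ∑ k ∈ Finset.range i, μ.rowLen k := by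
  classical
  have h1 : ∑ k ∈ Finset.range i, content T k =
      (μ.cells.filter fun c => T c.1 c.2 < i).card := by
    rw [Finset.card_eq_sum_card_fiberwise (f := fun c => T c.1 c.2) (t := Finset.range i)]
    · refine Finset.sum_congr rfl fun k hk => ?_
      rw [content_apply, Finset.filter_filter]
      congr 1
      refine Finset.filter_congr fun c _ => ?_
      have := Finset.mem_range.1 hk
      omega
    · intro c hc
      simpa using (Finset.mem_filter.1 hc).2
  rw [h1, ← card_filter_fst_lt]
  refine Finset.card_le_card ?_
  rintro ⟨a, b⟩ hc
  rw [Finset.mem_filter] at hc ⊢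
  exact ⟨hc.1, (fst_le_entry T a b (by simpa using hc.1)).trans_lt hc.2⟩

/-- Distinct Schur functions of degree `n` are linearly independent. Among the shapes with
non-zero coefficient one picks `μ` maximising the sum of all partial sums of its rows; by dominance
no other such shape carries a tableau with the content of the highest weight tableau of `μ`. -/
theorem eq_zero_of_sum_schur_eq_zero {n : ℕ} {f : YoungDiagram → ℝ[X]}
    (hf : ∑ μ ∈ partitionsOf n, MvPowerSeries.C (f μ) * schur μ = 0)
    {μ : YoungDiagram} (hμ : μ.card = n) : f μ = 0 := by
  classical
  by_contra hne
  set Φ : YoungDiagram → ℕ := fun μ =>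
    ∑ i ∈ Finset.range n, ∑ k ∈ Finset.range (i + 1), μ.rowLen k with hΦ
  obtain ⟨ξ, hξ, hmax⟩ := Finset.exists_max_image ((partitionsOf n).filter fun μ => f μ ≠ 0) Φ
    ⟨μ, Finset.mem_filter.2 ⟨mem_partitionsOf.2 hμ, hne⟩⟩
  obtain ⟨hξn, hξ0⟩ := Finset.mem_filter.1 hξ
  set m := content (SemistandardYoungTableau.highestWeight ξ) with hm
  have h1 := congrArg (MvPowerSeries.coeff m) hf
  rw [map_sum, map_zero] at h1
  simp_rw [MvPowerSeries.coeff_C_mul, coeff_schur] at h1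
  rw [Finset.sum_eq_single_of_mem ξ hξn] at h1
  · have := finite_content ξ m
    have h2 : 0 < Nat.card {T : SemistandardYoungTableau ξ // content T = m} :=
      Nat.card_pos_iff.2 ⟨⟨⟨_, rfl⟩⟩, this⟩
    rcases mul_eq_zero.1 h1 with h3 | h3
    · exact hξ0 h3
    · exact h2.ne' (by exact_mod_cast h3)
  · intro ρ hρ hρξ
    by_cases h3 : f ρ = 0
    · simp [h3]
    suffices h4 : IsEmpty {T : SemistandardYoungTableau ρ // content T = m} by simp
    refine ⟨fun ⟨T, hT⟩ => hρξ ?_⟩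
    have hle : ∀ i ∈ Finset.range n, ∑ k ∈ Finset.range (i + 1), ξ.rowLen k ≤
        ∑ k ∈ Finset.range (i + 1), ρ.rowLen k := by
      intro i _
      have := sum_content_le T (i + 1)
      rw [hT] at this
      simpa only [hm, content_highestWeight] using this
    have heq := (Finset.sum_eq_sum_iff_of_le hle).1
      (le_antisymm (Finset.sum_le_sum hle) (hmax ρ (Finset.mem_filter.2 ⟨hρ, h3⟩)))
    have hρn := mem_partitionsOf.1 hρ
    have hξn' := mem_partitionsOf.1 hξn
    refine ext_rowLen fun i => ?_
    by_cases hi : i < n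
    · have h5 := heq i (Finset.mem_range.2 hi)
      rw [Finset.sum_range_succ, Finset.sum_range_succ] at h5
      cases i with
      | zero => simpa using h5.symm
      | succ i =>
        have h6 := heq i (Finset.mem_range.2 (by omega))
        omega
    · rw [rowLen_eq_zero_of_card_le (by omega), rowLen_eq_zero_of_card_le (by omega)]

theorem schurSeries_injective : Function.Injective schurSeries := by
  intro F G hFG
  funext μ
  have h1 := congrArg (PowerSeries.coeff μ.card) hFG
  simp only [schurSeries, PowerSeries.coeff_mk] at h1
  refine sub_eq_zero.1 (eq_zero_of_sum_schur_eq_zero (n := μ.card) (f := fun μ => F μ - G μ) ?_ rfl)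
  simp only [map_sub, sub_mul, Finset.sum_sub_distrib, h1, sub_self]

/-! ### Removing the largest entries of a standard tableau -/

theorem SYT.entry_le {μ : YoungDiagram} (Q : SYT μ) {i i' j j' : ℕ} (hi : i ≤ i') (hj : j ≤ j')
    (hc : (i', j') ∈ μ) : Q.entry i j ≤ Q.entry i' j' := by
  have h1 : Q.entry i j ≤ Q.entry i j' := by
    rcases hj.eq_or_lt with rfl | hj
    · exact le_rfl
    · exact (Q.row_strict hj (μ.up_left_mem hi le_rfl hc)).le
  have h2 : Q.entry i j' ≤ Q.entry i' j' := by
    rcases hi.eq_or_lt with rfl | hi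
    · exact le_rfl
    · exact (Q.col_strict hi hc).le
  exact h1.trans h2

theorem SYT.one_le {μ : YoungDiagram} (Q : SYT μ) {i j : ℕ} (hc : (i, j) ∈ μ) :
    1 ≤ Q.entry i j := (Q.bij.mapsTo (x := (i, j)) hc).1

theorem SYT.le_card {μ : YoungDiagram} (Q : SYT μ) {i j : ℕ} (hc : (i, j) ∈ μ) :
    Q.entry i j ≤ μ.card := (Q.bij.mapsTo (x := (i, j)) hc).2

theorem SYT.exists_cell {μ : YoungDiagram} (Q : SYT μ) {k : ℕ} (h1 : 1 ≤ k) (h2 : k ≤ μ.card) :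
    ∃ c ∈ μ, Q.entry c.1 c.2 = k := by
  obtain ⟨c, hc, he⟩ := Q.bij.surjOn ⟨h1, h2⟩
  exact ⟨c, by simpa using hc, he⟩

theorem mem_Des {μ : YoungDiagram} {Q : SYT μ} {i : ℕ} :
    i ∈ Des Q ↔ ∃ c ∈ μ, ∃ d ∈ μ, Q.entry c.1 c.2 = i ∧ Q.entry d.1 d.2 = i + 1 ∧ c.1 < d.1 := by
  simp only [Des, Finset.mem_filter, Finset.mem_Icc, YoungDiagram.mem_cells,
    and_iff_right_iff_imp]
  rintro ⟨c, hc, d, hd, h1, h2, -⟩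
  have := Q.one_le (i := c.1) (j := c.2) hc
  have := Q.le_card (i := d.1) (j := d.2) hd
  omega

theorem Des_subset {μ : YoungDiagram} (Q : SYT μ) : Des Q ⊆ Finset.Icc 1 (μ.card - 1) :=
  Finset.filter_subset _ _

/-- The shape formed by the cells of `Q` with entry at most `m`. -/
def SYT.shapeLE {μ : YoungDiagram} (Q : SYT μ) (m : ℕ) : YoungDiagram where
  cells := μ.cells.filter fun c => Q.entry c.1 c.2 ≤ m
  isLowerSet := by
    rintro ⟨i, j⟩ ⟨i', j'⟩ hle hc
    simp only [Finset.coe_filter, YoungDiagram.mem_cells, Set.mem_ofPred_eq] at hc ⊢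
    exact ⟨μ.up_left_mem hle.1 hle.2 hc.1, (Q.entry_le hle.1 hle.2 hc.1).trans hc.2⟩

theorem SYT.mem_shapeLE {μ : YoungDiagram} {Q : SYT μ} {m : ℕ} {c : ℕ × ℕ} :
    c ∈ Q.shapeLE m ↔ c ∈ μ ∧ Q.entry c.1 c.2 ≤ m := by
  rw [← YoungDiagram.mem_cells]
  simp [shapeLE]

theorem SYT.card_filter_entry {μ : YoungDiagram} (Q : SYT μ) (s : Finset ℕ)
    (hs : s ⊆ Finset.Icc 1 μ.card) :
    (μ.cells.filter fun c => Q.entry c.1 c.2 ∈ s).card = s.card := by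
  refine Finset.card_nbij (fun c => Q.entry c.1 c.2) ?_ ?_ ?_
  · intro c hc
    exact (Finset.mem_filter.1 hc).2
  · intro c hc d hd hcd
    exact Q.bij.injOn (Finset.mem_filter.1 hc).1 (Finset.mem_filter.1 hd).1 hcd
  · intro k hk
    have := Finset.mem_Icc.1 (hs hk)
    obtain ⟨c, hc, rfl⟩ := Q.exists_cell this.1 this.2
    exact ⟨c, Finset.mem_filter.2 ⟨by simpa using hc, hk⟩, rfl⟩

theorem SYT.card_shapeLE {μ : YoungDiagram} (Q : SYT μ) {m : ℕ} (hm : m ≤ μ.card) :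
    (Q.shapeLE m).card = m := by
  have h1 := Q.card_filter_entry (Finset.Icc 1 m) (Finset.Icc_subset_Icc le_rfl hm)
  rw [Nat.card_Icc, Nat.add_sub_cancel] at h1
  rw [← h1]
  change (μ.cells.filter _).card = _
  congr 1
  refine Finset.filter_congr fun c hc => ?_
  have := Q.one_le (i := c.1) (j := c.2) (by simpa using hc)
  rw [Finset.mem_Icc]
  omega

/-- If `Q` has no descents above `m`, then larger entries beyond `m` lie weakly higher. -/
theorem SYT.row_le_of_entry_lt {μ : YoungDiagram} (Q : SYT μ) {m : ℕ}
    (hQ : ∀ d ∈ Des Q, d ≤ m) {c d : ℕ × ℕ} (hc : c ∈ μ) (hd : d ∈ μ)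
    (hm : m < Q.entry c.1 c.2) (hlt : Q.entry c.1 c.2 < Q.entry d.1 d.2) : d.1 ≤ c.1 := by
  obtain ⟨k, hk⟩ := Nat.exists_eq_add_of_lt hlt
  induction k generalizing d with
  | zero =>
    by_contra hcd
    have h1 := hQ _ (mem_Des.2 ⟨c, hc, d, hd, rfl, by omega, by omega⟩)
    omega
  | succ k ih =>
    have h0 := Q.le_card (i := d.1) (j := d.2) hd
    obtain ⟨e, he, hek⟩ := Q.exists_cell (k := Q.entry c.1 c.2 + k + 1) (by omega) (by omega)
    have h1 := ih he (by omega) hek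
    refine le_trans ?_ h1
    by_contra hcd
    have h2 := hQ _ (mem_Des.2 ⟨e, he, d, hd, rfl, by omega, by omega⟩)
    omega

theorem SYT.col_lt_of_entry_lt {μ : YoungDiagram} (Q : SYT μ) {m : ℕ}
    (hQ : ∀ d ∈ Des Q, d ≤ m) {c d : ℕ × ℕ} (hc : c ∈ μ) (hd : d ∈ μ)
    (hm : m < Q.entry c.1 c.2) (hlt : Q.entry c.1 c.2 < Q.entry d.1 d.2) : c.2 < d.2 := by
  by_contra hcd
  have h1 := Q.row_le_of_entry_lt hQ hc hd hm hlt
  have h2 := Q.entry_le h1 (not_lt.1 hcd) hc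
  omega

theorem SYT.isHorizontalStrip_shapeLE {μ : YoungDiagram} (Q : SYT μ) {m : ℕ}
    (hQ : ∀ d ∈ Des Q, d ≤ m) : IsHorizontalStrip (Q.shapeLE m) μ := by
  refine ⟨fun c hc => (mem_shapeLE.1 hc).1, fun i j hij => ?_⟩
  have hc := μ.up_left_mem (Nat.le_succ i) le_rfl hij
  refine mem_shapeLE.2 ⟨hc, ?_⟩
  by_contra hlt
  exact lt_irrefl _ (Q.col_lt_of_entry_lt hQ (c := (i, j)) (d := (i + 1, j)) hc hij (not_le.1 hlt)
    (Q.col_strict (Nat.lt_succ_self i) hij))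

/-- The restriction of a standard tableau to the shape of its smallest entries. -/
def SYT.restrict {ν μ : YoungDiagram} (hle : ν ≤ μ) (Q : SYT μ)
    (hQ : ∀ c ∈ μ, Q.entry c.1 c.2 ≤ ν.card ↔ c ∈ ν) : SYT ν where
  entry i j := if (i, j) ∈ ν then Q.entry i j else 0
  row_strict := by
    intro i j₁ j₂ hj hc
    rw [if_pos hc, if_pos (ν.up_left_mem le_rfl hj.le hc)]
    exact Q.row_strict hj (hle hc)
  col_strict := by
    intro i₁ i₂ j hi hc
    rw [if_pos hc, if_pos (ν.up_left_mem hi.le le_rfl hc)]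
    exact Q.col_strict hi (hle hc)
  bij := by
    have hmem : ∀ c : ℕ × ℕ, c ∈ (ν.cells : Set (ℕ × ℕ)) ↔ c ∈ ν := fun c => by simp
    have hmem' : ∀ c : ℕ × ℕ, c ∈ (μ.cells : Set (ℕ × ℕ)) ↔ c ∈ μ := fun c => by simp
    refine ⟨fun c hc => ?_, fun c hc d hd hcd => ?_, fun k hk => ?_⟩
    · rw [hmem] at hc
      change (if c ∈ ν then Q.entry c.1 c.2 else 0) ∈ _
      rw [if_pos hc]
      exact ⟨Q.one_le (hle hc), (hQ c (hle hc)).2 hc⟩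
    · rw [hmem] at hc hd
      change (if c ∈ ν then Q.entry c.1 c.2 else 0) = (if d ∈ ν then Q.entry d.1 d.2 else 0) at hcd
      rw [if_pos hc, if_pos hd] at hcd
      exact Q.bij.injOn ((hmem' c).2 (hle hc)) ((hmem' d).2 (hle hd)) hcd
    · obtain ⟨c, hc, he⟩ := Q.exists_cell hk.1 (hk.2.trans (card_le_of_le hle))
      have hcν : c ∈ ν := (hQ c hc).1 (he ▸ hk.2)
      refine ⟨c, (hmem c).2 hcν, ?_⟩
      change (if c ∈ ν then Q.entry c.1 c.2 else 0) = k
      rw [if_pos hcν, he]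
  zeros := fun hc => if_neg hc

theorem SYT.restrict_entry {ν μ : YoungDiagram} (hle : ν ≤ μ) (Q : SYT μ)
    (hQ : ∀ c ∈ μ, Q.entry c.1 c.2 ≤ ν.card ↔ c ∈ ν) (i j : ℕ) :
    (Q.restrict hle hQ).entry i j = if (i, j) ∈ ν then Q.entry i j else 0 := rfl

theorem Des_restrict {ν μ : YoungDiagram} (hle : ν ≤ μ) (Q : SYT μ)
    (hQ : ∀ c ∈ μ, Q.entry c.1 c.2 ≤ ν.card ↔ c ∈ ν) :
    Des (Q.restrict hle hQ) = (Des Q).filter (· < ν.card) := by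
  ext i
  rw [Finset.mem_filter, mem_Des, mem_Des]
  constructor
  · rintro ⟨c, hc, d, hd, h1, h2, h3⟩
    rw [SYT.restrict_entry, if_pos hc] at h1
    rw [SYT.restrict_entry, if_pos hd] at h2
    have := (hQ d (hle hd)).2 hd
    exact ⟨⟨c, hle hc, d, hle hd, h1, h2, h3⟩, by omega⟩
  · rintro ⟨⟨c, hc, d, hd, h1, h2, h3⟩, hi⟩
    have hc' := (hQ c hc).1 (by omega)
    have hd' := (hQ d hd).1 (by omega)
    refine ⟨c, hc', d, hd', ?_, ?_, h3⟩
    · rw [SYT.restrict_entry, if_pos hc', h1]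
    · rw [SYT.restrict_entry, if_pos hd', h2]

/-- The number of cells of `μ / ν` in the columns `0, …, j`. -/
def stripRank (ν μ : YoungDiagram) (j : ℕ) : ℕ :=
  (μ.cells.filter fun c => c ∉ ν ∧ c.2 ≤ j).card

theorem stripRank_lt {ν μ : YoungDiagram} {c : ℕ × ℕ} (hc : c ∈ μ) (hν : c ∉ ν) {j : ℕ}
    (hj : j < c.2) : stripRank ν μ j < stripRank ν μ c.2 := by
  refine Finset.card_lt_card (Finset.ssubset_iff_of_subset ?_ |>.2 ⟨c, ?_, ?_⟩)
  · intro d hd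
    rw [Finset.mem_filter] at hd ⊢
    exact ⟨hd.1, hd.2.1, hd.2.2.trans hj.le⟩
  · simp [hc, hν]
  · simp [hj]

theorem stripRank_pos {ν μ : YoungDiagram} {c : ℕ × ℕ} (hc : c ∈ μ) (hν : c ∉ ν) :
    0 < stripRank ν μ c.2 :=
  Finset.card_pos.2 ⟨c, by simp [hc, hν]⟩

theorem stripRank_le {ν μ : YoungDiagram} (hle : ν ≤ μ) (j : ℕ) :
    stripRank ν μ j ≤ μ.card - ν.card := by
  rw [← card_cells_sdiff hle]
  refine Finset.card_le_card fun c hc => ?_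
  rw [Finset.mem_filter] at hc ⊢
  exact ⟨hc.1, hc.2.1⟩

theorem IsHorizontalStrip.mem_of_lt {ν μ : YoungDiagram} (hs : IsHorizontalStrip ν μ)
    {i i' j j' : ℕ} (hi : i < i') (hj : j ≤ j') (hc : (i', j') ∈ μ) : (i, j) ∈ ν := by
  obtain ⟨k, rfl⟩ := Nat.exists_eq_add_of_lt hi
  exact ν.up_left_mem (Nat.le_add_right _ _) hj (hs.2 _ _ hc)

theorem IsHorizontalStrip.eq_of_snd_eq {ν μ : YoungDiagram} (hs : IsHorizontalStrip ν μ)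
    {c d : ℕ × ℕ} (hc : c ∈ μ) (hd : d ∈ μ) (hc' : c ∉ ν) (hd' : d ∉ ν) (hcd : c.2 = d.2) :
    c = d := by
  obtain ⟨i, j⟩ := c
  obtain ⟨i', j'⟩ := d
  simp only at hcd
  subst hcd
  rcases lt_trichotomy i i' with h1 | h1 | h1
  · exact absurd (hs.mem_of_lt h1 le_rfl hd) hc'
  · rw [h1]
  · exact absurd (hs.mem_of_lt h1 le_rfl hc) hd'

/-- The entries of the extension of a standard tableau by a horizontal strip, filled from left to
right. -/
def extendEntry {ν : YoungDiagram} (μ : YoungDiagram) (Q : SYT ν) (c : ℕ × ℕ) : ℕ :=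
  if c ∈ ν then Q.entry c.1 c.2 else if c ∈ μ then ν.card + stripRank ν μ c.2 else 0

theorem extendEntry_of_mem {ν : YoungDiagram} (μ : YoungDiagram) (Q : SYT ν) {c : ℕ × ℕ}
    (hc : c ∈ ν) : extendEntry μ Q c = Q.entry c.1 c.2 := if_pos hc

theorem extendEntry_of_not_mem {ν μ : YoungDiagram} (Q : SYT ν) {c : ℕ × ℕ} (hc : c ∈ μ)
    (hν : c ∉ ν) : extendEntry μ Q c = ν.card + stripRank ν μ c.2 := by
  rw [extendEntry, if_neg hν, if_pos hc]

theorem extendEntry_le_iff {ν μ : YoungDiagram} (Q : SYT ν) {c : ℕ × ℕ} (hc : c ∈ μ) :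
    extendEntry μ Q c ≤ ν.card ↔ c ∈ ν := by
  by_cases hν : c ∈ ν
  · simp only [extendEntry_of_mem μ Q hν, hν, iff_true]
    exact Q.le_card hν
  · rw [extendEntry_of_not_mem Q hc hν]
    have := stripRank_pos hc hν
    simp only [hν, iff_false]
    omega

/-- The extension of a standard tableau of shape `ν` to shape `μ`, filling the horizontal strip
`μ / ν` from left to right. -/
def SYT.extend {ν μ : YoungDiagram} (hs : IsHorizontalStrip ν μ) (Q : SYT ν) : SYT μ where
  entry i j := extendEntry μ Q (i, j)
  row_strict := by
    intro i j₁ j₂ hj hc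
    by_cases h2 : (i, j₂) ∈ ν
    · rw [extendEntry_of_mem _ _ h2, extendEntry_of_mem _ _ (ν.up_left_mem le_rfl hj.le h2)]
      exact Q.row_strict hj h2
    · have hc1 := μ.up_left_mem (le_refl i) hj.le hc
      rw [extendEntry_of_not_mem _ hc h2]
      by_cases h1 : (i, j₁) ∈ ν
      · have := (extendEntry_le_iff Q hc1).2 h1
        have := stripRank_pos hc h2
        omega
      · rw [extendEntry_of_not_mem _ hc1 h1]
        have := stripRank_lt hc h2 (j := j₁) hj
        simp only at *
        omega
  col_strict := by
    intro i₁ i₂ j hi hc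
    have h1 := hs.mem_of_lt hi le_rfl hc
    by_cases h2 : (i₂, j) ∈ ν
    · rw [extendEntry_of_mem _ _ h2, extendEntry_of_mem _ _ h1]
      exact Q.col_strict hi h2
    · have h3 := (extendEntry_le_iff Q (hs.1 h1)).2 h1
      have h4 := (extendEntry_le_iff Q hc).not.2 h2
      omega
  bij := by
    have hmaps : Set.MapsTo (extendEntry μ Q) μ.cells (Finset.Icc 1 μ.card : Finset ℕ) := by
      intro c hc
      have hc : c ∈ μ := by simpa using hc
      rw [Finset.coe_Icc, Set.mem_Icc]
      have hcard := hs.card_le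
      by_cases h1 : c ∈ ν
      · rw [extendEntry_of_mem _ _ h1]
        exact ⟨Q.one_le h1, (Q.le_card h1).trans hcard⟩
      · rw [extendEntry_of_not_mem _ hc h1]
        have := stripRank_pos hc h1
        have := stripRank_le hs.1 c.2
        omega
    have hinj : Set.InjOn (extendEntry μ Q) μ.cells := by
      intro c hc d hd hcd
      have hc : c ∈ μ := by simpa using hc
      have hd : d ∈ μ := by simpa using hd
      have h1 := extendEntry_le_iff Q hc
      have h2 := extendEntry_le_iff Q hd
      by_cases hcν : c ∈ ν
      · have hdν : d ∈ ν := by rw [← h2, ← hcd, h1]; exact hcν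
        rw [extendEntry_of_mem _ _ hcν, extendEntry_of_mem _ _ hdν] at hcd
        exact Q.bij.injOn (by simpa using hcν) (by simpa using hdν) hcd
      · have hdν : d ∉ ν := by rw [← h2, ← hcd, h1]; exact hcν
        rw [extendEntry_of_not_mem _ hc hcν, extendEntry_of_not_mem _ hd hdν] at hcd
        refine hs.eq_of_snd_eq hc hd hcν hdν ?_
        rcases lt_trichotomy c.2 d.2 with h3 | h3 | h3
        · have := stripRank_lt hd hdν h3; omega
        · exact h3
        · have := stripRank_lt hc hcν h3; omega
    have hsurj := Finset.surjOn_of_injOn_of_card_le _ hmaps hinj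
      (by rw [Nat.card_Icc, Nat.add_sub_cancel])
    rw [Finset.coe_Icc] at hmaps hsurj
    exact ⟨hmaps, hinj, hsurj⟩
  zeros := fun {i j} hc => by
    rw [extendEntry, if_neg fun h => hc (hs.1 h), if_neg hc]

theorem SYT.extend_entry {ν μ : YoungDiagram} (hs : IsHorizontalStrip ν μ) (Q : SYT ν)
    (i j : ℕ) : (Q.extend hs).entry i j = extendEntry μ Q (i, j) := rfl

theorem Des_extend_le {ν μ : YoungDiagram} (hs : IsHorizontalStrip ν μ) (Q : SYT ν) {k : ℕ}
    (hk : k ∈ Des (Q.extend hs)) : k ≤ ν.card := by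
  obtain ⟨c, hc, d, hd, h1, h2, h3⟩ := mem_Des.1 hk
  by_contra hlt
  simp only [SYT.extend_entry, Prod.mk.eta] at h1 h2
  have hcν : c ∉ ν := (extendEntry_le_iff Q hc).not.1 (by omega)
  have hdν : d ∉ ν := (extendEntry_le_iff Q hd).not.1 (by omega)
  rw [extendEntry_of_not_mem _ hc hcν] at h1
  rw [extendEntry_of_not_mem _ hd hdν] at h2
  by_cases h4 : c.2 ≤ d.2
  · exact hcν (hs.mem_of_lt h3 h4 hd)
  · have := stripRank_lt hc hcν (not_le.1 h4)
    omega

/-- Without descents above `|ν|`, the entries outside `ν` increase from left to right, so that they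
are determined by the shape. -/
theorem SYT.entry_eq_stripRank {ν μ : YoungDiagram} (Q : SYT μ)
    (hQ : ∀ c ∈ μ, Q.entry c.1 c.2 ≤ ν.card ↔ c ∈ ν) (hD : ∀ d ∈ Des Q, d ≤ ν.card)
    {c : ℕ × ℕ} (hc : c ∈ μ) (hν : c ∉ ν) : Q.entry c.1 c.2 = ν.card + stripRank ν μ c.2 := by
  have hlt := (hQ c hc).not.2 hν
  have h1 := Q.card_filter_entry (Finset.Icc (ν.card + 1) (Q.entry c.1 c.2)) (by
    intro k hk
    have h2 := Q.le_card (i := c.1) (j := c.2) hc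
    rw [Finset.mem_Icc] at hk ⊢
    omega)
  rw [Nat.card_Icc] at h1
  have h2 : stripRank ν μ c.2 = (μ.cells.filter fun d => Q.entry d.1 d.2 ∈
      Finset.Icc (ν.card + 1) (Q.entry c.1 c.2)).card := by
    rw [stripRank]
    congr 1
    refine Finset.filter_congr fun d hd => ?_
    have hd : d ∈ μ := by simpa using hd
    rw [← hQ d hd, Finset.mem_Icc]
    constructor
    · rintro ⟨h3, h4⟩
      refine ⟨by omega, ?_⟩
      by_contra h5
      have := Q.col_lt_of_entry_lt hD hc hd (by omega) (not_le.1 h5)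
      omega
    · rintro ⟨h3, h4⟩
      refine ⟨by omega, ?_⟩
      rcases h4.eq_or_lt with h5 | h5
      · have : d = c := Q.bij.injOn (by simpa using hd) (by simpa using hc) h5
        rw [this]
      · exact (Q.col_lt_of_entry_lt hD hd hc (by omega) h5).le
  omega

/-- Removing the entries larger than `|ν|` matches the standard tableaux of shape `μ` in which
these entries occupy `μ / ν` and no descent exceeds `|ν|` with the standard tableaux of
shape `ν`. -/
def SYT.restrictEquiv {ν μ : YoungDiagram} (hs : IsHorizontalStrip ν μ) :
    {Q : SYT μ // (∀ d ∈ Des Q, d ≤ ν.card) ∧ ∀ c ∈ μ, Q.entry c.1 c.2 ≤ ν.card ↔ c ∈ ν} ≃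
      SYT ν where
  toFun Q := Q.1.restrict hs.1 Q.2.2
  invFun Q := ⟨Q.extend hs, fun _ hd => Des_extend_le hs Q hd, fun _ hc =>
    extendEntry_le_iff Q hc⟩
  left_inv := by
    rintro ⟨Q, hD, hQ⟩
    apply Subtype.ext
    ext i j
    rw [extend_entry]
    by_cases h1 : (i, j) ∈ ν
    · rw [extendEntry_of_mem _ _ h1, restrict_entry, if_pos h1]
    · by_cases h2 : (i, j) ∈ μ
      · rw [extendEntry_of_not_mem _ h2 h1]
        exact (Q.entry_eq_stripRank hQ hD h2 h1).symm
      · rw [extendEntry, if_neg h1, if_neg h2, Q.zeros h2]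
  right_inv := by
    intro Q
    ext i j
    rw [restrict_entry, extend_entry]
    by_cases h1 : (i, j) ∈ ν
    · rw [if_pos h1, extendEntry_of_mem _ _ h1]
    · rw [if_neg h1, Q.zeros h1]

instance (μ : YoungDiagram) : Fintype (SYT μ) := Fintype.ofFinite _

open Classical in
/-- Summing over the tableaux left after removing the entries `m + 1, …, |μ|` from the tableaux in
which none of these entries is a descent. -/
theorem sum_stripsBelow_sum_SYT {A : Type*} [AddCommMonoid A] (μ : YoungDiagram) {m : ℕ}
    (hm : m ≤ μ.card) (f : Finset ℕ → A) :
    ∑ ν ∈ (stripsBelow μ).filter (fun ν => ν.card = m), ∑ Q : SYT ν, f (Des Q) =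
      ∑ Q : SYT μ with ∀ d ∈ Des Q, d ≤ m, f ((Des Q).filter (· < m)) := by
  rw [← Finset.sum_fiberwise_of_maps_to (t := (stripsBelow μ).filter fun ν => ν.card = m)
    (g := fun Q : SYT μ => Q.shapeLE m)]
  · refine Finset.sum_congr rfl fun ν hν => ?_
    obtain ⟨h1, rfl⟩ := Finset.mem_filter.1 hν
    rw [mem_stripsBelow] at h1
    rw [← (SYT.restrictEquiv h1).sum_comp, Finset.filter_filter]
    refine Finset.sum_bij (fun Q _ => Q.1) ?_ ?_ ?_ ?_
    · rintro ⟨Q, hD, hQ⟩ -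
      refine Finset.mem_filter.2 ⟨Finset.mem_univ _, hD, ?_⟩
      refine YoungDiagram.ext (Finset.ext fun c => ?_)
      rw [YoungDiagram.mem_cells, YoungDiagram.mem_cells, SYT.mem_shapeLE]
      exact ⟨fun h => (hQ c h.1).1 h.2, fun h => ⟨h1.1 h, (hQ c (h1.1 h)).2 h⟩⟩
    · intro Q _ Q' _ h
      exact Subtype.ext h
    · intro Q hQ
      obtain ⟨-, hD, hsh⟩ := Finset.mem_filter.1 hQ
      refine ⟨⟨Q, hD, fun c hc => ?_⟩, Finset.mem_univ _, rfl⟩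
      have h2 : c ∈ Q.shapeLE ν.card ↔ c ∈ ν := by rw [hsh]
      rw [← h2, SYT.mem_shapeLE]
      simp [hc]
    · rintro ⟨Q, hD, hQ⟩ -
      exact congrArg f (Des_restrict h1.1 Q hQ)
  · intro Q hQ
    have hD := (Finset.mem_filter.1 hQ).2
    exact Finset.mem_filter.2
      ⟨mem_stripsBelow.2 (Q.isHorizontalStrip_shapeLE hD), Q.card_shapeLE hm⟩

/-! ### Weights of descent sets -/

/-- The factor contributed to the weight `weightR` by a block of `m` consecutive letters, and to
`weightP` by such a block that does not come first. -/
def blockWeight : ℕ → ℝ[X]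
  | 0 => 1
  | 1 => 0
  | m + 2 => X * (1 + X) ^ m

/-- The factor contributed to the weight `weightP` by a first block of `m` letters. -/
def firstBlockWeight : ℕ → ℝ[X]
  | 0 => 1
  | m + 1 => (1 + X) ^ m

theorem sum_pow_mul_succ (g : ℕ → ℝ[X]) (b : ℕ) :
    ∑ a ∈ Finset.range (b + 2), X ^ a * g (b + 1 - a) =
      X * (∑ a ∈ Finset.range (b + 1), X ^ a * g (b - a)) + g (b + 1) := by
  rw [Finset.sum_range_succ', Finset.mul_sum]
  congr 1
  · refine Finset.sum_congr rfl fun a _ => ?_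
    rw [Nat.add_sub_add_right, pow_succ]
    ring
  · simp

theorem sum_reflect_succ (g : ℕ → ℝ[X]) (b : ℕ) :
    ∑ a ∈ Finset.range (b + 2), g (b + 1 - a) =
      (∑ a ∈ Finset.range (b + 1), g (b - a)) + g (b + 1) := by
  rw [Finset.sum_range_succ']
  congr 1
  refine Finset.sum_congr rfl fun a _ => ?_
  rw [Nat.add_sub_add_right]

theorem sum_blockWeight (b : ℕ) :
    ∑ a ∈ Finset.range (b + 2), X ^ a * blockWeight (b + 1 - a) = X * (1 + X) ^ b ∧
      ∑ a ∈ Finset.range (b + 2), blockWeight (b + 1 - a) = (1 + X) ^ b := by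
  induction b with
  | zero => simp [Finset.sum_range_succ, blockWeight]
  | succ b ih =>
    rw [sum_pow_mul_succ, sum_reflect_succ, ih.1, ih.2, blockWeight]
    constructor <;> ring

theorem conv_blockWeight {b : ℕ} (hb : 1 ≤ b) :
    ∑ a ∈ Finset.range (b + 1), (X ^ a - X) * blockWeight (b - a) = 0 := by
  obtain ⟨b, rfl⟩ := Nat.exists_eq_add_of_le' hb
  simp only [sub_mul, Finset.sum_sub_distrib, ← Finset.mul_sum]
  rw [(sum_blockWeight b).1, (sum_blockWeight b).2, sub_self]

theorem sum_firstBlockWeight (b : ℕ) :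
    ∑ a ∈ Finset.range (b + 1), X ^ a * firstBlockWeight (b - a) = (1 + X) ^ b ∧
      X * ∑ a ∈ Finset.range (b + 1), firstBlockWeight (b - a) = (1 + X) ^ b - 1 + X := by
  induction b with
  | zero => simp [firstBlockWeight]
  | succ b ih =>
    rw [sum_pow_mul_succ, sum_reflect_succ, mul_add, ih.1, ih.2, firstBlockWeight]
    constructor <;> ring

theorem conv_firstBlockWeight (b : ℕ) :
    ∑ a ∈ Finset.range (b + 1), (X ^ a - X) * firstBlockWeight (b - a) = 1 - X := by
  simp only [sub_mul, Finset.sum_sub_distrib, ← Finset.mul_sum]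
  rw [(sum_firstBlockWeight b).1, (sum_firstBlockWeight b).2]
  ring

open Classical in
/-- The contribution to `R_μ` of a standard tableau of size `n` with descent set `D`: the product
of the weights of the blocks into which `D` cuts `1, …, n`. The case `n = 1` is separated since the
single block then has weight `0`, although `∅` is stable in the empty interval. -/
def weightR (n : ℕ) (D : Finset ℕ) : ℝ[X] :=
  if n = 0 then 1 else if 2 ≤ n ∧ D ∈ Stab (Finset.Icc 2 (n - 2)) then
    X ^ (D.card + 1) * (1 + X) ^ (n - 2 * (D.card + 1)) else 0

open Classical in
/-- The contribution to `P_μ` of a standard tableau of size `n` with descent set `D`: the product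
of the weights of its blocks, the first one weighted by `firstBlockWeight`. -/
def weightP (n : ℕ) (D : Finset ℕ) : ℝ[X] :=
  if n = 0 then 1 else if D ∈ Stab (Finset.Icc 1 (n - 2)) then
    X ^ D.card * (1 + X) ^ (n - 1 - 2 * D.card) else 0

/-- A stable set has at most half as many elements as the interval containing it and its
successors. -/
theorem two_mul_card_le_of_mem_Stab {D : Finset ℕ} {a b : ℕ} (hD : D ∈ Stab (Finset.Icc a b)) :
    2 * D.card ≤ b + 2 - a := by
  classical
  have h1 : Disjoint D (D.image (· + 1)) := by
    rw [Finset.disjoint_left]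
    intro x hx hx'
    obtain ⟨y, hy, rfl⟩ := Finset.mem_image.1 hx'
    exact hD.2 y hy hx
  have h2 : D ∪ D.image (· + 1) ⊆ Finset.Icc a (b + 1) := by
    intro x hx
    rcases Finset.mem_union.1 hx with hx | hx
    · have := Finset.mem_Icc.1 (hD.1 hx)
      exact Finset.mem_Icc.2 (by omega)
    · obtain ⟨y, hy, rfl⟩ := Finset.mem_image.1 hx
      have := Finset.mem_Icc.1 (hD.1 hy)
      exact Finset.mem_Icc.2 (by omega)
  have h3 := Finset.card_le_card h2
  rw [Finset.card_union_of_disjoint h1, Finset.card_image_of_injective _ (add_left_injective 1),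
    Nat.card_Icc] at h3
  omega

theorem insert_mem_Stab_iff {D : Finset ℕ} {k d m : ℕ} (hk : 1 ≤ k) (hD : ∀ x ∈ D, x < d)
    (hdm : d < m) : insert d D ∈ Stab (Finset.Icc k (m - 2)) ↔
      k ≤ d ∧ d + 2 ≤ m ∧ D ∈ Stab (Finset.Icc k (d - 2)) := by
  constructor
  · rintro ⟨h1, h2⟩
    have h3 := Finset.mem_Icc.1 (h1 (Finset.mem_insert_self d D))
    refine ⟨h3.1, by omega, fun x hx => ?_, fun x hx hx' => ?_⟩
    · have h4 := Finset.mem_Icc.1 (h1 (Finset.mem_insert_of_mem hx))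
      have h5 := hD x hx
      have h6 := h2 x (Finset.mem_insert_of_mem hx)
      rw [Finset.mem_insert, not_or] at h6
      exact Finset.mem_Icc.2 (by omega)
    · exact h2 x (Finset.mem_insert_of_mem hx) (Finset.mem_insert_of_mem hx')
  · rintro ⟨h1, h2, h3, h4⟩
    refine ⟨fun x hx => ?_, fun x hx hx' => ?_⟩
    · rcases Finset.mem_insert.1 hx with rfl | hx
      · exact Finset.mem_Icc.2 (by omega)
      · have := Finset.mem_Icc.1 (h3 hx)
        exact Finset.mem_Icc.2 (by omega)
    · rcases Finset.mem_insert.1 hx with rfl | hx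
      · rcases Finset.mem_insert.1 hx' with h5 | h5
        · omega
        · have := hD _ h5; omega
      · rcases Finset.mem_insert.1 hx' with h5 | h5
        · have := Finset.mem_Icc.1 (h3 hx); omega
        · exact h4 x hx h5

theorem filter_insert_lt {D : Finset ℕ} {d m : ℕ} (hD : ∀ x ∈ D, x < d) (hdm : d ≤ m) :
    (insert d D).filter (· < m) = if d = m then D else insert d D := by
  split_ifs with h1
  · subst h1
    rw [Finset.filter_insert, if_neg (lt_irrefl _), Finset.filter_true_of_mem hD]
  · refine Finset.filter_true_of_mem fun x hx => ?_
    rcases Finset.mem_insert.1 hx with rfl | hx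
    · omega
    · have := hD x hx; omega

theorem weightR_insert {D : Finset ℕ} {d m : ℕ} (hd : 1 ≤ d) (hD : ∀ x ∈ D, x < d)
    (hdm : d ≤ m) :
    weightR m ((insert d D).filter (· < m)) = weightR d D * blockWeight (m - d) := by
  rw [filter_insert_lt hD hdm]
  split_ifs with h1
  · simp [h1, blockWeight]
  have hdD : d ∉ D := fun h2 => lt_irrefl _ (hD d h2)
  rw [weightR, weightR, if_neg (show ¬ m = 0 by omega), if_neg (show ¬ d = 0 by omega),
    insert_mem_Stab_iff (by omega) hD (by omega), Finset.card_insert_of_notMem hdD]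
  obtain ⟨k, rfl⟩ := Nat.exists_eq_add_of_le hdm
  rw [Nat.add_sub_cancel_left]
  match k with
  | 0 => omega
  | 1 => rw [if_neg (by omega), blockWeight, mul_zero]
  | k + 2 =>
    by_cases h2 : 2 ≤ d ∧ D ∈ Stab (Finset.Icc 2 (d - 2))
    · have h3 := two_mul_card_le_of_mem_Stab h2.2
      rw [if_pos ⟨by omega, h2.1, by omega, h2.2⟩, if_pos h2, blockWeight,
        show d + (k + 2) - 2 * (D.card + 1 + 1) = (d - 2 * (D.card + 1)) + k by omega]
      ring
    · rw [if_neg fun h3 => h2 ⟨h3.2.1, h3.2.2.2⟩, if_neg h2, zero_mul]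

theorem weightP_insert {D : Finset ℕ} {d m : ℕ} (hd : 1 ≤ d) (hD : ∀ x ∈ D, x < d)
    (hdm : d ≤ m) :
    weightP m ((insert d D).filter (· < m)) = weightP d D * blockWeight (m - d) := by
  rw [filter_insert_lt hD hdm]
  split_ifs with h1
  · simp [h1, blockWeight]
  have hdD : d ∉ D := fun h2 => lt_irrefl _ (hD d h2)
  rw [weightP, weightP, if_neg (show ¬ m = 0 by omega), if_neg (show ¬ d = 0 by omega),
    insert_mem_Stab_iff le_rfl hD (by omega), Finset.card_insert_of_notMem hdD]
  obtain ⟨k, rfl⟩ := Nat.exists_eq_add_of_le hdm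
  rw [Nat.add_sub_cancel_left]
  match k with
  | 0 => omega
  | 1 => rw [if_neg (by omega), blockWeight, mul_zero]
  | k + 2 =>
    by_cases h2 : D ∈ Stab (Finset.Icc 1 (d - 2))
    · have h3 : 2 * D.card ≤ d - 1 := by
        rcases hd.eq_or_lt with rfl | hd
        · have : D = ∅ := by
            refine Finset.eq_empty_of_forall_notMem fun x hx => ?_
            have := Finset.mem_Icc.1 (h2.1 hx)
            omega
          simp [this]
        · have := two_mul_card_le_of_mem_Stab h2
          omega
      rw [if_pos ⟨hd, by omega, h2⟩, if_pos h2, blockWeight,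
        show d + (k + 2) - 1 - 2 * (D.card + 1) = (d - 1 - 2 * D.card) + k by omega]
      ring
    · rw [if_neg fun h3 => h2 h3.2.2, if_neg h2, zero_mul]

theorem weightR_empty (m : ℕ) : weightR m ∅ = blockWeight m := by
  have h0 : ∀ k, (∅ : Finset ℕ) ∈ Stab (Finset.Icc 2 k) := fun k => ⟨by simp, by simp⟩
  match m with
  | 0 => simp [weightR, blockWeight]
  | 1 => simp [weightR, blockWeight]
  | m + 2 => simp [weightR, blockWeight, h0]

theorem weightP_empty (m : ℕ) : weightP m ∅ = firstBlockWeight m := by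
  have h0 : ∀ k, (∅ : Finset ℕ) ∈ Stab (Finset.Icc 1 k) := fun k => ⟨by simp, by simp⟩
  match m with
  | 0 => simp [weightP, firstBlockWeight]
  | m + 1 => simp [weightP, firstBlockWeight, h0]

/-- If the part of a weight beyond the largest descent factors as a block weight, then removing a
final segment without descents in its interior gives a vanishing signed sum. -/
theorem sum_weight_eq_zero {w : ℕ → Finset ℕ → ℝ[X]}
    (hw : ∀ {D : Finset ℕ} {d m : ℕ}, 1 ≤ d → (∀ x ∈ D, x < d) → d ≤ m →
      w m ((insert d D).filter (· < m)) = w d D * blockWeight (m - d))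
    {n : ℕ} {D : Finset ℕ} (hD : D ⊆ Finset.Icc 1 (n - 1)) (hne : D.Nonempty) :
    (∑ a ∈ Finset.range (n + 1), if ∀ d ∈ D, d ≤ n - a then
      (X ^ a - X) * w (n - a) (D.filter (· < n - a)) else 0) = 0 := by
  obtain ⟨d, hd, hmax⟩ : ∃ d ∈ D, ∀ x ∈ D, x ≤ d :=
    ⟨D.max' hne, D.max'_mem hne, fun x hx => D.le_max' x hx⟩
  have hdn := Finset.mem_Icc.1 (hD hd)
  have hlt : ∀ x ∈ D.erase d, x < d := fun x hx =>
    lt_of_le_of_ne (hmax x (Finset.mem_of_mem_erase hx)) (Finset.ne_of_mem_erase hx)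
  have hif : ∀ a, (∀ x ∈ D, x ≤ n - a) ↔ d ≤ n - a := fun a =>
    ⟨fun h => h d hd, fun h x hx => (hmax x hx).trans h⟩
  -- The segments removed never reach beyond the last block, of length `n - d`.
  have hkey := congrArg (w d (D.erase d) * ·) (conv_blockWeight (b := n - d) (by omega))
  simp only [mul_zero, Finset.mul_sum] at hkey
  refine Eq.trans ?_ hkey
  simp_rw [hif]
  rw [← Finset.sum_filter]
  have hr : (Finset.range (n + 1)).filter (fun a => d ≤ n - a) = Finset.range (n - d + 1) := by
    ext a
    simp only [Finset.mem_filter, Finset.mem_range]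
    omega
  rw [hr]
  refine Finset.sum_congr rfl fun a ha => ?_
  have := Finset.mem_range.1 ha
  rw [← Finset.insert_erase hd, hw hdn.1 hlt (by omega), Finset.insert_erase hd,
    show n - a - d = n - d - a by omega]
  ring

theorem sum_weightR {n : ℕ} (hn : 1 ≤ n) {D : Finset ℕ} (hD : D ⊆ Finset.Icc 1 (n - 1)) :
    (∑ a ∈ Finset.range (n + 1), if ∀ d ∈ D, d ≤ n - a then
      (X ^ a - X) * weightR (n - a) (D.filter (· < n - a)) else 0) = 0 := by
  rcases D.eq_empty_or_nonempty with rfl | hne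
  · simp [weightR_empty, conv_blockWeight hn]
  · exact sum_weight_eq_zero weightR_insert hD hne

theorem sum_weightP {n : ℕ} {D : Finset ℕ} (hD : D ⊆ Finset.Icc 1 (n - 1)) :
    (∑ a ∈ Finset.range (n + 1), if ∀ d ∈ D, d ≤ n - a then
      (X ^ a - X) * weightP (n - a) (D.filter (· < n - a)) else 0) =
        if D = ∅ then 1 - X else 0 := by
  rcases D.eq_empty_or_nonempty with rfl | hne
  · simp [weightP_empty, conv_firstBlockWeight]
  · rw [if_neg hne.ne_empty]
    exact sum_weight_eq_zero weightP_insert hD hne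

/-! ### The generating functions -/

/-- The sum of the weights of the descent sets of all standard tableaux of a given shape. -/
def desSum (w : ℕ → Finset ℕ → ℝ[X]) (μ : YoungDiagram) : ℝ[X] :=
  ∑ Q : SYT μ, w μ.card (Des Q)

open Classical in
/-- The left-hand side of the recursion for a sum of weights, as a sum over tableaux of the full
shape: the horizontal strips removed become final segments without descents. -/
theorem sum_stripsBelow_desSum (w : ℕ → Finset ℕ → ℝ[X]) (μ : YoungDiagram) :
    ∑ ν ∈ stripsBelow μ, (X ^ (μ.card - ν.card) - X) * desSum w ν =
      ∑ Q : SYT μ, ∑ a ∈ Finset.range (μ.card + 1), if ∀ d ∈ Des Q, d ≤ μ.card - a then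
        (X ^ a - X) * w (μ.card - a) ((Des Q).filter (· < μ.card - a)) else 0 := by
  rw [Finset.sum_comm, ← Finset.sum_fiberwise_of_maps_to (t := Finset.range (μ.card + 1))
    (g := fun ν : YoungDiagram => μ.card - ν.card)]
  · refine Finset.sum_congr rfl fun a ha => ?_
    have ha' := Finset.mem_range.1 ha
    have h1 := sum_stripsBelow_sum_SYT μ (m := μ.card - a) (by omega)
      (fun D => (X ^ a - X) * w (μ.card - a) D)
    rw [← Finset.sum_filter, ← h1]
    refine Finset.sum_congr ?_ fun ν hν => ?_
    · refine Finset.filter_congr fun ν hν => ?_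
      have := (mem_stripsBelow.1 hν).card_le
      omega
    · have h2 := (Finset.mem_filter.1 hν).2
      have h3 := (mem_stripsBelow.1 (Finset.mem_filter.1 hν).1).card_le
      rw [desSum, Finset.mul_sum, h2, show μ.card - (μ.card - a) = a by omega]
  · intro ν _
    exact Finset.mem_range.2 (by omega)

instance : Unique (SYT ⊥) where
  default :=
    { entry := fun _ _ => 0
      row_strict := fun _ hc => absurd hc (by simp)
      col_strict := fun _ hc => absurd hc (by simp)
      bij := by
        rw [card_bot]
        simp
      zeros := fun _ => rfl }
  uniq Q := by
    ext i j
    rw [Q.zeros (by simp)]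

theorem Des_bot (Q : SYT ⊥) : Des Q = ∅ := by
  have := Des_subset Q
  rw [card_bot] at this
  simpa using this

theorem desSum_bot (w : ℕ → Finset ℕ → ℝ[X]) : desSum w ⊥ = w 0 ∅ := by
  simp [desSum, Des_bot, card_bot]

open Classical in
/-- A shape carries a standard tableau without descents exactly when it is a row, and then only
one. -/
theorem card_Des_empty (μ : YoungDiagram) :
    (Finset.univ.filter fun Q : SYT μ => Des Q = ∅).card =
      if IsHorizontalStrip ⊥ μ then 1 else 0 := by
  have h1 := sum_stripsBelow_sum_SYT μ (Nat.zero_le _) (fun _ => (1 : ℕ))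
  have h2 : ∀ Q : SYT μ, (∀ d ∈ Des Q, d ≤ 0) ↔ Des Q = ∅ := by
    intro Q
    rw [Finset.eq_empty_iff_forall_notMem]
    refine forall_congr' fun d => ⟨fun h hd => ?_, fun h hd => absurd hd h⟩
    have := Finset.mem_Icc.1 (Des_subset Q hd)
    have := h hd
    omega
  simp_rw [h2] at h1
  rw [Finset.card_eq_sum_ones, ← h1]
  have h3 : (stripsBelow μ).filter (fun ν => ν.card = 0) =
      if IsHorizontalStrip ⊥ μ then {⊥} else ∅ := by
    ext ν
    rw [Finset.mem_filter, mem_stripsBelow]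
    split_ifs with h
    · rw [Finset.mem_singleton]
      refine ⟨fun h4 => eq_bot_of_card h4.2, ?_⟩
      rintro rfl
      exact ⟨h, card_bot⟩
    · simp only [Finset.notMem_empty, iff_false]
      rintro ⟨h4, h5⟩
      rw [eq_bot_of_card h5] at h4
      exact h h4
  rw [h3]
  split_ifs <;> simp

open Classical in
theorem sum_stripsBelow_desSum_weightR (μ : YoungDiagram) :
    ∑ ν ∈ stripsBelow μ, (X ^ (μ.card - ν.card) - X) * desSum weightR ν =
      if μ = ⊥ then 1 - X else 0 := by
  split_ifs with h
  · subst h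
    have h1 : stripsBelow ⊥ = {⊥} := by
      ext ν
      rw [mem_stripsBelow, isHorizontalStrip_bot_right, Finset.mem_singleton]
    rw [h1, Finset.sum_singleton, desSum_bot]
    simp [weightR]
  · rw [sum_stripsBelow_desSum]
    refine Finset.sum_eq_zero fun Q _ => ?_
    refine (Finset.sum_congr rfl fun a _ => ?_).trans
      (sum_weightR (Nat.one_le_iff_ne_zero.2 fun h0 => h (eq_bot_of_card h0)) (Des_subset Q))
    split_ifs <;> rfl

open Classical in
theorem sum_stripsBelow_desSum_weightP (μ : YoungDiagram) :
    ∑ ν ∈ stripsBelow μ, (X ^ (μ.card - ν.card) - X) * desSum weightP ν =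
      if IsHorizontalStrip ⊥ μ then 1 - X else 0 := by
  have h1 : ∀ Q : SYT μ, (∑ a ∈ Finset.range (μ.card + 1),
      if ∀ d ∈ Des Q, d ≤ μ.card - a then
        (X ^ a - X) * weightP (μ.card - a) ((Des Q).filter (· < μ.card - a)) else 0) =
      if Des Q = ∅ then 1 - X else 0 := by
    intro Q
    refine (Finset.sum_congr rfl fun a _ => ?_).trans
      ((sum_weightP (Des_subset Q)).trans ?_) <;> split_ifs <;> rfl
  rw [sum_stripsBelow_desSum]
  simp_rw [h1]
  rw [← Finset.sum_filter, Finset.sum_const, card_Des_empty]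
  split_ifs <;> simp

theorem coeff_den (n : ℕ) :
    PowerSeries.coeff n den = MvPowerSeries.C (X ^ n - X : ℝ[X]) * h n := by
  simp [den, Ht, H, t, PowerSeries.coeff_rescale, PowerSeries.coeff_C_mul, sub_mul]

/-- Multiplying a Schur expansion by the denominator, by the Pieri rule. -/
theorem coeff_schurSeries_mul_den (F : YoungDiagram → ℝ[X]) (n : ℕ) :
    PowerSeries.coeff n (schurSeries F * den) =
      ∑ ξ ∈ partitionsOf n, MvPowerSeries.C
        (∑ ν ∈ stripsBelow ξ, (X ^ (ξ.card - ν.card) - X) * F ν) * schur ξ := by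
  classical
  have h1 : ∀ k ∈ Finset.range (n + 1),
      PowerSeries.coeff k (schurSeries F) * PowerSeries.coeff (n - k) den =
      ∑ μ ∈ partitionsOf k, ∑ ξ ∈ stripsAbove μ n,
        MvPowerSeries.C ((X ^ (n - μ.card) - X) * F μ) * schur ξ := by
    intro k hk
    have hk := Finset.mem_range.1 hk
    rw [coeff_den, schurSeries, PowerSeries.coeff_mk, Finset.sum_mul]
    refine Finset.sum_congr rfl fun μ hμ => ?_
    have hμ := mem_partitionsOf.1 hμ
    have h2 := h_mul_schur (n - k) μ
    rw [show μ.card + (n - k) = n by omega] at h2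
    rw [← Finset.mul_sum, ← h2, hμ, map_mul]
    ring
  rw [PowerSeries.coeff_mul, Finset.Nat.sum_antidiagonal_eq_sum_range_succ_mk,
    Finset.sum_congr rfl h1, ← Finset.sum_biUnion]
  · rw [Finset.sum_comm' (t' := partitionsOf n) (s' := stripsBelow)]
    · refine Finset.sum_congr rfl fun ξ hξ => ?_
      rw [← Finset.sum_mul, map_sum, mem_partitionsOf.1 hξ]
    · intro ν ξ
      simp only [Finset.mem_biUnion, Finset.mem_range, mem_partitionsOf, mem_stripsAbove,
        mem_stripsBelow]
      constructor
      · rintro ⟨-, h2, h3⟩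
        exact ⟨h3, h2⟩
      · rintro ⟨h3, h2⟩
        have := h3.card_le
        exact ⟨⟨ν.card, by omega, rfl⟩, h2, h3⟩
  · intro i _ j _ hij
    rw [Function.onFun, Finset.disjoint_left]
    intro μ h2 h3
    exact hij ((mem_partitionsOf.1 h2).symm.trans (mem_partitionsOf.1 h3))

theorem schurSeries_weightR_mul_den : schurSeries (desSum weightR) * den = numR := by
  classical
  ext1 n
  rw [coeff_schurSeries_mul_den, numR, PowerSeries.coeff_C]
  simp_rw [sum_stripsBelow_desSum_weightR]
  split_ifs with h
  · subst h
    rw [Finset.sum_eq_single_of_mem ⊥ (mem_partitionsOf.2 card_bot)]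
    · simp [schur_bot, t]
    · intro μ hμ h1
      exact absurd (eq_bot_of_card (mem_partitionsOf.1 hμ)) h1
  · refine Finset.sum_eq_zero fun μ hμ => ?_
    rw [if_neg, map_zero, zero_mul]
    rintro rfl
    exact h (mem_partitionsOf.1 hμ).symm

theorem schurSeries_weightP_mul_den : schurSeries (desSum weightP) * den = numP := by
  classical
  ext1 n
  rw [coeff_schurSeries_mul_den, numP, PowerSeries.coeff_C_mul, H, PowerSeries.coeff_mk,
    h_eq_sum_schur, Finset.mul_sum, stripsAbove, Finset.sum_filter]
  simp_rw [sum_stripsBelow_desSum_weightP]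
  refine Finset.sum_congr rfl fun μ _ => ?_
  split_ifs <;> simp [t]

theorem div_den_eq_iff (f g : PowerSeries SymRing) :
    algebraMap _ Frac f / algebraMap _ Frac den = algebraMap _ Frac g ↔ g * den = f := by
  have hinj := IsFractionRing.injective (PowerSeries SymRing) Frac
  have h0 : algebraMap _ Frac den ≠ 0 := fun h0 =>
    den_ne_zero (hinj (h0.trans (map_zero _).symm))
  rw [div_eq_iff h0, ← map_mul]
  exact ⟨fun h => (hinj h).symm, fun h => congrArg _ h.symm⟩

theorem isP_iff (P : YoungDiagram → ℝ[X]) : IsP P ↔ P = desSum weightP := by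
  rw [IsP, div_den_eq_iff, ← schurSeries_weightP_mul_den]
  refine ⟨fun h => schurSeries_injective (mul_right_cancel₀ den_ne_zero h), ?_⟩
  rintro rfl
  rfl

theorem isR_iff (R : YoungDiagram → ℝ[X]) : IsR R ↔ R = desSum weightR := by
  rw [IsR, div_den_eq_iff, ← schurSeries_weightR_mul_den]
  refine ⟨fun h => schurSeries_injective (mul_right_cancel₀ den_ne_zero h), ?_⟩
  rintro rfl
  rfl

/-! ### The `γ`-expansions -/

theorem desSum_weightP {μ : YoungDiagram} (hμ : 1 ≤ μ.card) :
    desSum weightP μ = ∑ i ∈ Finset.range ((μ.card - 1) / 2 + 1),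
      (gammaNum μ i : ℝ[X]) * X ^ i * (1 + X) ^ (μ.card - 1 - 2 * i) := by
  classical
  simp only [desSum, weightP, if_neg (show ¬ μ.card = 0 by omega)]
  rw [← Finset.sum_filter, ← Finset.sum_fiberwise_of_maps_to
    (t := Finset.range ((μ.card - 1) / 2 + 1)) (g := fun Q : SYT μ => (Des Q).card)]
  · refine Finset.sum_congr rfl fun i _ => ?_
    rw [gammaNum, Nat.card_eq_fintype_card, Fintype.card_subtype, Finset.filter_filter, mul_assoc,
      ← nsmul_eq_mul, ← Finset.sum_const]
    exact Finset.sum_congr rfl fun Q hQ => by rw [(Finset.mem_filter.1 hQ).2.2]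
  · intro Q hQ
    have h1 := (Finset.mem_filter.1 hQ).2
    have h2 := two_mul_card_le_of_mem_Stab h1
    have h3 := Finset.card_le_card (Des_subset Q)
    rw [Nat.card_Icc] at h3
    exact Finset.mem_range.2 (by omega)

theorem desSum_weightR {μ : YoungDiagram} (hμ : 1 ≤ μ.card) :
    desSum weightR μ = ∑ i ∈ Finset.range (μ.card / 2 + 1),
      (xiNum μ i : ℝ[X]) * X ^ i * (1 + X) ^ (μ.card - 2 * i) := by
  classical
  have hx0 : xiNum μ 0 = 0 := by
    have : IsEmpty {Q : SYT μ // Des Q ∈ Stab (Finset.Icc 2 (μ.card - 2)) ∧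
      (Des Q).card + 1 = 0} := ⟨fun Q => absurd Q.2.2 (Nat.succ_ne_zero _)⟩
    exact Nat.card_of_isEmpty
  rcases hμ.eq_or_lt with h1 | h1
  · rw [← h1]
    simp [desSum, weightR, ← h1, hx0]
  simp only [desSum, weightR, if_neg (show ¬ μ.card = 0 by omega),
    show (2 ≤ μ.card) = True from eq_true h1, true_and]
  rw [← Finset.sum_filter, ← Finset.sum_fiberwise_of_maps_to
    (t := Finset.range (μ.card / 2 + 1)) (g := fun Q : SYT μ => (Des Q).card + 1)]
  · refine Finset.sum_congr rfl fun i _ => ?_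
    rw [xiNum, Nat.card_eq_fintype_card, Fintype.card_subtype, Finset.filter_filter, mul_assoc,
      ← nsmul_eq_mul, ← Finset.sum_const]
    exact Finset.sum_congr rfl fun Q hQ => by rw [(Finset.mem_filter.1 hQ).2.2]
  · intro Q hQ
    have h2 := two_mul_card_le_of_mem_Stab (Finset.mem_filter.1 hQ).2
    exact Finset.mem_range.2 (by omega)

theorem gammaPositive_one : GammaPositive 1 :=
  ⟨0, fun _ => 1, fun _ => zero_le_one, by simp⟩

theorem gammaPositive_of_eq_sum {f : ℝ[X]} {m : ℕ} {c : ℕ → ℕ}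
    (hf : f = ∑ i ∈ Finset.range (m / 2 + 1), (c i : ℝ[X]) * X ^ i * (1 + X) ^ (m - 2 * i)) :
    GammaPositive f :=
  ⟨m, fun i => c i, fun i => Nat.cast_nonneg _, by simpa using hf⟩

end GammaSchur

end

theorem mainTheorem2 :
    (∃! P : YoungDiagram → ℝ[X], GammaSchur.IsP P) ∧
    (∃! R : YoungDiagram → ℝ[X], GammaSchur.IsR R) ∧
    ∀ P R : YoungDiagram → ℝ[X], GammaSchur.IsP P → GammaSchur.IsR R →
      (∀ (n : ℕ) (μ : YoungDiagram), 1 ≤ n → μ.card = n →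
        P μ = ∑ i ∈ Finset.range ((n - 1) / 2 + 1),
          (GammaSchur.gammaNum μ i : ℝ[X]) * X ^ i * (1 + X) ^ (n - 1 - 2 * i) ∧
        R μ = ∑ i ∈ Finset.range (n / 2 + 1),
          (GammaSchur.xiNum μ i : ℝ[X]) * X ^ i * (1 + X) ^ (n - 2 * i)) ∧
      (∀ μ : YoungDiagram,
        GammaSchur.GammaPositive (P μ) ∧ GammaSchur.GammaPositive (R μ)) := by
  open GammaSchur in
  simp only [isP_iff, isR_iff]
  refine ⟨existsUnique_eq, existsUnique_eq, ?_⟩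
  rintro P R rfl rfl
  refine ⟨?_, fun μ => ?_⟩
  · rintro n μ hn rfl
    exact ⟨desSum_weightP hn, desSum_weightR hn⟩
  · rcases Nat.eq_zero_or_pos μ.card with h0 | h0
    · rw [eq_bot_of_card h0, desSum_bot, desSum_bot]
      simpa [weightP, weightR] using gammaPositive_one
    · exact ⟨gammaPositive_of_eq_sum (desSum_weightP h0),
        gammaPositive_of_eq_sum (desSum_weightR h0)⟩
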